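/- Consider a polynomial control-affine system with $n$ states, $m$ inputs and $r$ outputs, $$\dot x=\underbrace{Ax+\sum_{p=2}^{\ell}F_p x^{\otimes p}}_{f(x)}+\underbrace{\Big(\sum_{p=1}^{\ell}G_p(x^{\otimes p}\otimes I_m)+B\Big)}_{g(x)}u,\qquad y=\underbrace{Cx+\sum_{p=2}^{\ell}H_p x^{\otimes p}}_{h(x)},$$ with $A\in\mathbb R^{n\times n}$, $F_p\in\mathbb R^{n\times n^p}$, $B\in\mathbb R^{n\times m}$, $G_p\in\mathbb R^{n\times n^pm}$, $C\in\mathbb R^{r\times n}$, $H_p\in\mathbb R^{r\times n^p}$. Put $G_0:=B$, $H_1:=C$ and $F_p,G_p,H_p:=0$ for $p>\ell$. Let $\gamma_0$ be the infimum of all $\tilde\gamma$ (assumed to exist) for which some linear time-invariant output-feedback controller $y\mapsto u$ of finite order internally stabilizes the plant $\dot x=Ax+B(u+w_1)$, $y=Cx+w_2$ and makes the $\mathcal H_\infty$ norm of the closed loop from $(w_1,w_2)$ to $(Cx,u)$ less than $\tilde\gamma$. Let $\gamma>\gamma_0$ (so $\gamma_0\ge 0$ and $\gamma>0$) and $\eta=1-\gamma^{-2}$.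 Let $\mathcal E^-$ (the past energy function) be a smooth solution near $0$, with $\mathcal E^-(0)=0$, of $$0=\partial\mathcal E^-\,f+\tfrac12\,\partial\mathcal E^-\,gg^\top\,\partial^\top\mathcal E^--\tfrac{\eta}{2}h^\top h$$ such that $0$ is an asymptotically stable equilibrium of the vector field $-f-gg^\top\partial^\top\mathcal E^-$; let $\mathcal E^+$ (the future energy function) be a smooth solution near $0$, with $\mathcal E^+(0)=0$, of $$0=\partial\mathcal E^+\,f-\tfrac{\eta}{2}\,\partial\mathcal E^+\,gg^\top\,\partial^\top\mathcal E^++\tfrac12h^\top h$$ such that $0$ is an asymptotically stable equilibrium of $f-\eta gg^\top\partial^\top\mathcal E^+$. Let $V_2,W_2$ be the symmetric matrices with $\mathcal E^-(x)=\frac12x^\top V_2x+o(|x|^2)$ and $\mathcal E^+(x)=\frac12x^\top W_2x+o(|x|^2)$, and put $v_2=\mathrm{vec}[V_2]$, $w_2=\mathrm{vec}[W_2]$. Notation: $\mathrm{vec}$ stacks the columns of a matrix; for $M\in\mathbb R^{a\times b}$, $\mathcal L_k(M)=\sum_{s=1}^kI_a^{\otimes(s-1)}\otimes M\otimes I_a^{\otimes(k-s)}$;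 $S_{b\times a}$ is the permutation matrix with $\mathrm{vec}[M^\top]=S_{b\times a}\mathrm{vec}[M]$ for $M\in\mathbb R^{a\times b}$; for $v_i\in\mathbb R^{n^i}$, $V_i\in\mathbb R^{n\times n^{i-1}}$ is the matrix with $\mathrm{vec}[V_i]=v_i$, and similarly for $w_i,W_i$. For $k\ge3$ and $v=(v_2,\dots,v_{k-1})$ put $$\Phi_k(v)=\sum_{\substack{i,p\ge2\\ i+p=k+1}}\mathcal L_i(F_p)^\top v_i,\qquad \Psi_k(v)=\sum_{\substack{i,j>2\\ i+j=k+2}}ij\,\mathrm{vec}[V_i^\top BB^\top V_j],\qquad \Theta_k=\sum_{\substack{p,q\ge1\\ p+q=k}}\mathrm{vec}[H_p^\top H_q],$$ $$\Gamma_k(v)=\sum_{o=1}^{2\ell}\ \sum_{\substack{p,q\ge0\\ p+q=o}}\ \sum_{\substack{i,j\ge2\\ i+j=k-o+2}}ij\,\mathrm{vec}\Big[(I_{n^p}\otimes\mathrm{vec}[I_m]^\top)\big(\mathrm{vec}[G_q^\top V_j]^\top\otimes(G_p^\top V_i\otimes I_m)\big)(I_{n^{j-1}}\otimes S_{n^{i-1}\times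 n^qm}\otimes I_m)(I_{n^{k-p}}\otimes\mathrm{vec}[I_m])\Big].$$ Then for every $k\ge3$ and all $v_i,w_i\in\mathbb R^{n^i}$, $3\le i\le k-1$ (in particular for the symmetric Taylor coefficients of $2\mathcal E^-$ and $2\mathcal E^+$, or for symmetrized solutions of the systems of lower degree), each of the linear systems $$\mathcal L_k(A+BB^\top V_2)^\top\tilde v_k=-\Phi_k(v)-\tfrac14\Psi_k(v)+\eta\,\Theta_k-\tfrac14\Gamma_k(v),$$ $$\mathcal L_k(A-\eta BB^\top W_2)^\top\tilde w_k=-\Phi_k(w)+\tfrac{\eta}{4}\Psi_k(w)-\Theta_k+\tfrac{\eta}{4}\Gamma_k(w)$$ has exactly one solution, $\tilde v_k\in\mathbb R^{n^k}$ and $\tilde w_k\in\mathbb R^{n^k}$ respectively. -/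

import Mathlib

open Filter Topology Asymptotics Matrix Finset
open scoped Kronecker ContDiff Gradient

noncomputable section

namespace NLBalancing

/-! ### Kronecker calculus on flat indices

Vectors of `ℝ^N` are functions `Fin N → ℝ`, and all Kronecker products are taken with their usual
lexicographic ordering of the entries, so that they are associative up to the casts below. -/

/-- Reading a vector of length `a` as a vector of length `b`, when `a = b`. -/
def castVec {a b : ℕ} (h : a = b) (v : Fin a → ℝ) : Fin b → ℝ :=
  fun t => v (Fin.cast h.symm t)

/-- Reading an `a × b` matrix as an `a' × b'` matrix, when `a = a'` and `b = b'`. -/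
def castMat {a b a' b' : ℕ} (h₁ : a = a') (h₂ : b = b') (M : Matrix (Fin a) (Fin b) ℝ) :
    Matrix (Fin a') (Fin b') ℝ :=
  M.submatrix (Fin.cast h₁.symm) (Fin.cast h₂.symm)

/-- The Kronecker product `A ⊗ B` as a `ps × qt` block matrix. -/
def kron {p q s t : ℕ} (A : Matrix (Fin p) (Fin q) ℝ) (B : Matrix (Fin s) (Fin t) ℝ) :
    Matrix (Fin (p * s)) (Fin (q * t)) ℝ :=
  Matrix.reindex finProdFinEquiv finProdFinEquiv (A ⊗ₖ B)

/-- `vec[A]`: the columns of `A` stacked into one vector. -/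
def vecMat {p q : ℕ} (A : Matrix (Fin p) (Fin q) ℝ) : Fin (q * p) → ℝ :=
  fun t => A (finProdFinEquiv.symm t).2 (finProdFinEquiv.symm t).1

/-- A vector as a matrix with one column. -/
def colMat {N : ℕ} (v : Fin N → ℝ) : Matrix (Fin N) (Fin 1) ℝ := fun a _ => v a

/-- A vector as a matrix with one row. -/
def rowMat {N : ℕ} (v : Fin N → ℝ) : Matrix (Fin 1) (Fin N) ℝ := fun _ a => v a

/-- The perfect shuffle matrix `S_{q × p}`: the permutation matrix with `vec[Aᵀ] = S_{q × p} vec[A]`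
for every `p × q` matrix `A` (this is `perm_mulVec_vecMat`). -/
def perm (q p : ℕ) : Matrix (Fin (p * q)) (Fin (q * p)) ℝ :=
  fun s t => if finProdFinEquiv.symm t = (finProdFinEquiv.symm s).swap then 1 else 0

theorem perm_mulVec_vecMat {p q : ℕ} (A : Matrix (Fin p) (Fin q) ℝ) :
    perm q p *ᵥ vecMat A = vecMat Aᵀ := by
  funext s
  simp only [perm, vecMat, mulVec, dotProduct, Equiv.symm_apply_eq, ite_mul, one_mul, zero_mul,
    Finset.sum_ite_eq', Finset.mem_univ, if_true, Equiv.symm_apply_apply, Prod.snd_swap,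
    Prod.fst_swap, transpose_apply]

/-- The Kronecker power `x^{⊗ k} = x ⊗ ⋯ ⊗ x ∈ ℝ^{n^k}`. -/
def kronPow {n : ℕ} (x : Fin n → ℝ) : (k : ℕ) → Fin (n ^ k) → ℝ
  | 0 => fun _ => 1
  | k + 1 => castVec (pow_succ n k).symm fun t : Fin (n ^ k * n) =>
      kronPow x k (finProdFinEquiv.symm t).1 * x (finProdFinEquiv.symm t).2

theorem lyap_dim (p q k : ℕ) (s : Fin k) :
    p ^ (s : ℕ) * q * p ^ (k - 1 - s) = p ^ (k - 1) * q := by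
  have h : (s : ℕ) + (k - 1 - s) = k - 1 := by omega
  rw [← h, pow_add, h]; ring

theorem lyap_dim' (p k : ℕ) (s : Fin k) : p ^ (s : ℕ) * p * p ^ (k - 1 - s) = p ^ k := by
  rw [lyap_dim, ← pow_succ, Nat.sub_add_cancel (by have := s.isLt; omega)]

/-- The `k`-way Lyapunov matrix
`𝓛ₖ(A) = ∑ᵢ I_p ⊗ ⋯ ⊗ A ⊗ ⋯ ⊗ I_p` (`k` factors, `A` in the `i`-th position) of a `p × q` matrix. -/
def lyap {p q : ℕ} (k : ℕ) (A : Matrix (Fin p) (Fin q) ℝ) :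
    Matrix (Fin (p ^ k)) (Fin (p ^ (k - 1) * q)) ℝ :=
  ∑ s : Fin k, castMat (lyap_dim' p k s) (lyap_dim p q k s)
    (kron (kron (1 : Matrix (Fin (p ^ (s : ℕ))) (Fin (p ^ (s : ℕ))) ℝ) A)
      (1 : Matrix (Fin (p ^ (k - 1 - s))) (Fin (p ^ (k - 1 - s))) ℝ))

theorem pow_pred_mul (n : ℕ) {i : ℕ} (hi : 1 ≤ i) : n ^ (i - 1) * n = n ^ i := by
  rw [← pow_succ, Nat.sub_add_cancel hi]

/-- The `n × n^{i-1}` matrix `Vᵢ` with `vec[Vᵢ] = vᵢ`. -/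
def unvec {n i : ℕ} (hi : 1 ≤ i) (v : Fin (n ^ i) → ℝ) :
    Matrix (Fin n) (Fin (n ^ (i - 1))) ℝ :=
  fun a b => v (Fin.cast (pow_pred_mul n hi) (finProdFinEquiv (b, a)))

/-! ### Polynomial control-affine systems -/

/-- The data of a polynomial control-affine system
`ẋ = A x + ∑_{p=2}^ℓ F_p x^{⊗p} + (∑_{p=1}^ℓ G_p (x^{⊗p} ⊗ I_m) + B) u`,
`y = C x + ∑_{p=2}^ℓ H_p x^{⊗p}` with `n` states, `m` inputs and `r` outputs. Entries of the
families `F`, `G`, `H` outside the ranges of these sums are never used. -/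
structure PolySystem (n m r : ℕ) where
  ℓ : ℕ
  A : Matrix (Fin n) (Fin n) ℝ
  B : Matrix (Fin n) (Fin m) ℝ
  C : Matrix (Fin r) (Fin n) ℝ
  F : (p : ℕ) → Matrix (Fin n) (Fin (n ^ p)) ℝ
  G : (p : ℕ) → Matrix (Fin n) (Fin (n ^ p * m)) ℝ
  H : (p : ℕ) → Matrix (Fin r) (Fin (n ^ p)) ℝ

namespace PolySystem

variable {n m r : ℕ} (S : PolySystem n m r)

/-- The drift `f(x)`. -/
def f (x : Fin n → ℝ) : Fin n → ℝ :=
  S.A *ᵥ x + ∑ p ∈ Icc 2 S.ℓ, S.F p *ᵥ kronPow x p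

/-- The input map `g(x)`. -/
def g (x : Fin n → ℝ) : Matrix (Fin n) (Fin m) ℝ :=
  (∑ p ∈ Icc 1 S.ℓ, castMat rfl (one_mul m)
    (S.G p * kron (colMat (kronPow x p)) (1 : Matrix (Fin m) (Fin m) ℝ))) + S.B

/-- The output map `h(x)`. -/
def h (x : Fin n → ℝ) : Fin r → ℝ :=
  S.C *ᵥ x + ∑ p ∈ Icc 2 S.ℓ, S.H p *ᵥ kronPow x p

/-- The drift coefficient `F_p`, `p ≥ 2`, which is zero beyond the degree of the system. -/
def coeffF (p : ℕ) : Matrix (Fin n) (Fin (n ^ p)) ℝ :=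
  if p ≤ S.ℓ then S.F p else 0

/-- The input coefficient `G_p`, `p ≥ 0`, with `G₀ = B`, zero beyond the degree of the system. -/
def coeffG : (p : ℕ) → Matrix (Fin n) (Fin (n ^ p * m)) ℝ
  | 0 => castMat rfl (by simp) S.B
  | p + 1 => if p + 1 ≤ S.ℓ then S.G (p + 1) else 0

/-- The output coefficient `H_p`, `p ≥ 1`, with `H₁ = C`, zero beyond the degree of the system. -/
def coeffH : (p : ℕ) → Matrix (Fin r) (Fin (n ^ p)) ℝ
  | 0 => 0
  | 1 => castMat rfl (pow_one n).symm S.C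
  | p + 2 => if p + 2 ≤ S.ℓ then S.H (p + 2) else 0

end PolySystem

/-! ### Linear controllers, the closed loop and its `H∞` norm -/

/-- A square real matrix all of whose (complex) eigenvalues have negative real part. -/
def IsHurwitz {ι : Type*} [Fintype ι] [DecidableEq ι] (M : Matrix ι ι ℝ) : Prop :=
  ∀ μ ∈ spectrum ℂ (M.map (fun a : ℝ => (a : ℂ))), μ.re < 0

open scoped Matrix.Norms.L2Operator in
/-- The `H∞` norm `sup_θ ‖C (iθ I - A)⁻¹ B + D‖` (largest singular value) of the transfer function
of the state-space system `(A, B, C, D)`; meant for Hurwitz `A`. -/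
def hinfNorm {ι κ ν : Type*} [Fintype ι] [DecidableEq ι] [Fintype κ] [DecidableEq κ]
    [Fintype ν] [DecidableEq ν] (A : Matrix ι ι ℝ) (B : Matrix ι κ ℝ) (C : Matrix ν ι ℝ)
    (D : Matrix ν κ ℝ) : ENNReal :=
  ⨆ θ : ℝ, ENNReal.ofReal
    ‖C.map (fun a : ℝ => (a : ℂ)) *
        ((Complex.I * (θ : ℂ)) • (1 : Matrix ι ι ℂ) - A.map (fun a : ℝ => (a : ℂ)))⁻¹ *
        B.map (fun a : ℝ => (a : ℂ)) + D.map (fun a : ℝ => (a : ℂ))‖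

/-- A linear time-invariant output-feedback controller of order `s`:
`ξ̇ = A ξ + B y`, `u = C ξ + D y`. -/
structure Controller (m r s : ℕ) where
  A : Matrix (Fin s) (Fin s) ℝ
  B : Matrix (Fin s) (Fin r) ℝ
  C : Matrix (Fin m) (Fin s) ℝ
  D : Matrix (Fin m) (Fin r) ℝ

namespace Controller

/-! The closed loop is that of the normalized `H∞` control problem for the plant `(A, B, C)`:
`ẋ = A x + B (u + w₁)`, `y = C x + w₂`, with the controller from `y` to `u`, the disturbance
`w = (w₁, w₂)` and the regulated output `z = (C x, u)`; the state is `(x, ξ)`. -/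

variable {n m r s : ℕ} (K : Controller m r s) (A : Matrix (Fin n) (Fin n) ℝ)
  (B : Matrix (Fin n) (Fin m) ℝ) (C : Matrix (Fin r) (Fin n) ℝ)

/-- The state matrix of the closed loop. -/
def clA : Matrix (Fin n ⊕ Fin s) (Fin n ⊕ Fin s) ℝ :=
  fromBlocks (A + B * K.D * C) (B * K.C) (K.B * C) K.A

/-- The matrix from the disturbance to the state derivative. -/
def clB : Matrix (Fin n ⊕ Fin s) (Fin m ⊕ Fin r) ℝ :=
  fromBlocks B (B * K.D) 0 K.B

/-- The matrix from the state to the regulated output. -/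
def clC : Matrix (Fin r ⊕ Fin m) (Fin n ⊕ Fin s) ℝ :=
  fromBlocks C 0 (K.D * C) K.C

/-- The feedthrough matrix from the disturbance to the regulated output. -/
def clD : Matrix (Fin r ⊕ Fin m) (Fin m ⊕ Fin r) ℝ :=
  fromBlocks 0 0 0 K.D

/-- The controller stabilizes the plant internally. -/
def Stabilizes : Prop := IsHurwitz (K.clA A B C)

/-- The `H∞` norm of the closed loop from `w` to `z`. -/
def closedLoopNorm : ENNReal :=
  hinfNorm (K.clA A B C) (K.clB B) (K.clC C) K.clD

end Controller

/-- The performance levels `c` for which some stabilizing controller makes the `H∞` norm of the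
closed loop less than `c`. -/
def admissibleLevels {n m r : ℕ} (A : Matrix (Fin n) (Fin n) ℝ)
    (B : Matrix (Fin n) (Fin m) ℝ) (C : Matrix (Fin r) (Fin n) ℝ) : Set ℝ :=
  {c | ∃ (s : ℕ) (K : Controller m r s),
    K.Stabilizes A B C ∧ K.closedLoopNorm A B C < ENNReal.ofReal c}

/-! ### Asymptotic stability and the energy functions -/

/-- `x` solves `ẋ = X(x)` on `[0, ∞)`. -/
def IsSolution {n : ℕ} (X : EuclideanSpace ℝ (Fin n) → EuclideanSpace ℝ (Fin n))
    (x : ℝ → EuclideanSpace ℝ (Fin n)) : Prop :=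
  ∀ t, 0 ≤ t → HasDerivWithinAt x (X (x t)) (Set.Ici 0) t

/-- (Local) asymptotic stability, in the sense of Lyapunov, of the equilibrium `0` of `ẋ = X(x)`. -/
structure AsymptoticallyStable {n : ℕ}
    (X : EuclideanSpace ℝ (Fin n) → EuclideanSpace ℝ (Fin n)) : Prop where
  stable : ∀ ε > 0, ∃ δ > 0, ∀ x₀, ‖x₀‖ < δ →
    (∃ x, IsSolution X x ∧ x 0 = x₀) ∧
      ∀ x, IsSolution X x → x 0 = x₀ → ∀ t, 0 ≤ t → ‖x t‖ < ε
  attractive : ∃ δ > 0, ∀ x, IsSolution X x → ‖x 0‖ < δ → Tendsto x atTop (𝓝 0)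

section Energy

variable {n m r : ℕ} (S : PolySystem n m r) (η : ℝ) (E : EuclideanSpace ℝ (Fin n) → ℝ)

/-- `E` is the past energy function near `0`: the smooth solution, vanishing at `0`, of
`0 = ∂E f + ½ ∂E g gᵀ ∂ᵀE - (η/2) hᵀ h` for which `-f - g gᵀ ∂ᵀE` is asymptotically stable. -/
structure IsPastEnergy : Prop where
  smooth : ContDiffAt ℝ ∞ E 0
  zero : E 0 = 0
  hjb : ∀ᶠ x in 𝓝 (0 : EuclideanSpace ℝ (Fin n)),
    (∇ E x).ofLp ⬝ᵥ S.f x.ofLp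
      + 1 / 2 * ((∇ E x).ofLp ⬝ᵥ ((S.g x.ofLp * (S.g x.ofLp)ᵀ) *ᵥ (∇ E x).ofLp))
      - η / 2 * (S.h x.ofLp ⬝ᵥ S.h x.ofLp) = 0
  stable : AsymptoticallyStable fun x : EuclideanSpace ℝ (Fin n) =>
    WithLp.toLp 2 (-S.f x.ofLp - (S.g x.ofLp * (S.g x.ofLp)ᵀ) *ᵥ (∇ E x).ofLp)

/-- `E` is the future energy function near `0`: the smooth solution, vanishing at `0`, of
`0 = ∂E f - (η/2) ∂E g gᵀ ∂ᵀE + ½ hᵀ h` for which `f - η g gᵀ ∂ᵀE` is asymptotically stable. -/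
structure IsFutureEnergy : Prop where
  smooth : ContDiffAt ℝ ∞ E 0
  zero : E 0 = 0
  hjb : ∀ᶠ x in 𝓝 (0 : EuclideanSpace ℝ (Fin n)),
    (∇ E x).ofLp ⬝ᵥ S.f x.ofLp
      - η / 2 * ((∇ E x).ofLp ⬝ᵥ ((S.g x.ofLp * (S.g x.ofLp)ᵀ) *ᵥ (∇ E x).ofLp))
      + 1 / 2 * (S.h x.ofLp ⬝ᵥ S.h x.ofLp) = 0
  stable : AsymptoticallyStable fun x : EuclideanSpace ℝ (Fin n) =>
    WithLp.toLp 2 (S.f x.ofLp - η • ((S.g x.ofLp * (S.g x.ofLp)ᵀ) *ᵥ (∇ E x).ofLp))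

/-- `V` is symmetric and `E(x) = ½ xᵀ V x` up to terms of degree greater than two. -/
def HasQuadraticPart (V : Matrix (Fin n) (Fin n) ℝ) : Prop :=
  V.IsSymm ∧
    (fun x : EuclideanSpace ℝ (Fin n) => E x - 1 / 2 * (x.ofLp ⬝ᵥ (V *ᵥ x.ofLp)))
      =o[𝓝 0] fun x => ‖x‖ ^ 2

end Energy

/-! ### The linear systems for the coefficients of degree `k`

`v` is the family of coefficient vectors `vᵢ ∈ ℝ^{n^i}`. Only `v₂, …, v_{k-1}` enter the
right-hand side for the degree `k`. In each sum a pair `ij` or `pq` runs over an antidiagonal, that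
is, over all pairs of naturals with the prescribed sum, and the condition of the `if` selects the
range of the sum. -/

section LinearSystems

variable {n m r : ℕ} (S : PolySystem n m r)

theorem dim_F (n : ℕ) {i p k : ℕ} (h : 2 ≤ i ∧ 2 ≤ p ∧ i + p = k + 1) :
    n ^ (i - 1) * n ^ p = n ^ k := by
  rw [← pow_add]; congr 1; omega

theorem dim_B (n : ℕ) {i j k : ℕ} (h : 2 < i ∧ 2 < j ∧ i + j = k + 2) :
    n ^ (j - 1) * n ^ (i - 1) = n ^ k := by
  rw [← pow_add]; congr 1; omega

theorem dim_H (n : ℕ) {p q k : ℕ} (h : 1 ≤ p ∧ 1 ≤ q ∧ p + q = k) :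
    n ^ q * n ^ p = n ^ k := by
  rw [← pow_add]; congr 1; omega

/-- `∑_{i,p ≥ 2, i+p = k+1} 𝓛ᵢ(F_p)ᵀ vᵢ`. -/
def termF (v : (i : ℕ) → Fin (n ^ i) → ℝ) (k : ℕ) : Fin (n ^ k) → ℝ :=
  ∑ ip ∈ antidiagonal (k + 1),
    if h : 2 ≤ ip.1 ∧ 2 ≤ ip.2 ∧ ip.1 + ip.2 = k + 1 then
      castVec (dim_F n h) ((lyap ip.1 (S.coeffF ip.2))ᵀ *ᵥ v ip.1)
    else 0

/-- `∑_{i,j > 2, i+j = k+2} i j vec[Vᵢᵀ B Bᵀ Vⱼ]`. -/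
def termB (v : (i : ℕ) → Fin (n ^ i) → ℝ) (k : ℕ) : Fin (n ^ k) → ℝ :=
  ∑ ij ∈ antidiagonal (k + 2),
    if h : 2 < ij.1 ∧ 2 < ij.2 ∧ ij.1 + ij.2 = k + 2 then
      ((ij.1 : ℝ) * (ij.2 : ℝ)) • castVec (dim_B n h)
        (vecMat ((unvec (by omega) (v ij.1))ᵀ * S.B * S.Bᵀ * unvec (by omega) (v ij.2)))
    else 0

/-- `∑_{p,q ≥ 1, p+q = k} vec[H_pᵀ H_q]`. -/
def termH (k : ℕ) : Fin (n ^ k) → ℝ :=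
  ∑ pq ∈ antidiagonal k,
    if h : 1 ≤ pq.1 ∧ 1 ≤ pq.2 ∧ pq.1 + pq.2 = k then
      castVec (dim_H n h) (vecMat ((S.coeffH pq.1)ᵀ * S.coeffH pq.2))
    else 0

theorem dim_G₁ (a m : ℕ) : a * (m * m) = 1 * (a * m * m) := by ring

theorem dim_G₂ (a b c m : ℕ) : b * c * (a * m) = b * (c * a) * m := by ring

theorem dim_G₃ (n m : ℕ) {i j p q k : ℕ} (h : 2 ≤ i ∧ 2 ≤ j ∧ i + j + (p + q) = k + 2) :
    n ^ (j - 1) * (n ^ (i - 1) * (n ^ q * m)) * m = n ^ (k - p) * (m * m) := by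
  have e : k - p = (j - 1) + (i - 1) + q := by omega
  rw [e, pow_add, pow_add]; ring

theorem dim_G₄ (n : ℕ) {i j p q k : ℕ} (h : 2 ≤ i ∧ 2 ≤ j ∧ i + j + (p + q) = k + 2) :
    n ^ (k - p) * 1 * (n ^ p * 1) = n ^ k := by
  rw [mul_one, mul_one, ← pow_add]; congr 1; omega

/-- The vector
`vec[(I_{n^p} ⊗ vec[I_m]ᵀ) (vec[G_qᵀ Vⱼ]ᵀ ⊗ (G_pᵀ Vᵢ ⊗ I_m))
  (I_{n^{j-1}} ⊗ S_{n^{i-1} × n^q m} ⊗ I_m) (I_{n^{k-p}} ⊗ vec[I_m])]`. -/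
def vecG (v : (i : ℕ) → Fin (n ^ i) → ℝ) {i j p q k : ℕ}
    (h : 2 ≤ i ∧ 2 ≤ j ∧ i + j + (p + q) = k + 2) : Fin (n ^ k) → ℝ :=
  let Im : Matrix (Fin m) (Fin m) ℝ := 1
  let Vi := unvec (by omega) (v i)
  let Vj := unvec (by omega) (v j)
  let M₁ := kron (1 : Matrix (Fin (n ^ p)) (Fin (n ^ p)) ℝ) (rowMat (vecMat Im))
  let M₂ := kron (rowMat (vecMat ((S.coeffG q)ᵀ * Vj))) (kron ((S.coeffG p)ᵀ * Vi) Im)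
  let M₃ := kron (kron (1 : Matrix (Fin (n ^ (j - 1))) (Fin (n ^ (j - 1))) ℝ)
    (perm (n ^ (i - 1)) (n ^ q * m))) Im
  let M₄ := kron (1 : Matrix (Fin (n ^ (k - p))) (Fin (n ^ (k - p))) ℝ) (colMat (vecMat Im))
  castVec (dim_G₄ n h)
    (vecMat (castMat rfl (dim_G₁ (n ^ p) m) M₁ *
      castMat rfl (dim_G₂ (n ^ (i - 1)) (n ^ (j - 1)) (n ^ q * m) m) M₂ *
      castMat rfl (dim_G₃ n m h) M₃ * M₄))

/-- `∑_{o=1}^{2ℓ} ∑_{p,q ≥ 0, p+q = o} ∑_{i,j ≥ 2, i+j = k-o+2} i j vec[⋯]` with the vectors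
`vecG`. -/
def termG (v : (i : ℕ) → Fin (n ^ i) → ℝ) (k : ℕ) : Fin (n ^ k) → ℝ :=
  ∑ o ∈ Icc 1 (2 * S.ℓ), ∑ pq ∈ antidiagonal o, ∑ ij ∈ antidiagonal (k + 2 - o),
    if h : 2 ≤ ij.1 ∧ 2 ≤ ij.2 ∧ ij.1 + ij.2 + (pq.1 + pq.2) = k + 2 then
      ((ij.1 : ℝ) * (ij.2 : ℝ)) • vecG S v h
    else 0

theorem dim_L (n : ℕ) {k : ℕ} (hk : 3 ≤ k) : n ^ (k - 1) * n = n ^ k :=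
  pow_pred_mul n (by omega)

/-- `t` solves the linear system of degree `k` for the past energy function:
`𝓛ₖ(A + B Bᵀ V₂)ᵀ t = -∑ 𝓛ᵢ(F_p)ᵀ vᵢ - ¼ ∑ ij vec[Vᵢᵀ B Bᵀ Vⱼ] + η ∑ vec[H_pᵀ H_q] - ¼ ∑ ∑ ∑ ⋯`. -/
def SolvesPastSystem (η : ℝ) (V₂ : Matrix (Fin n) (Fin n) ℝ) (v : (i : ℕ) → Fin (n ^ i) → ℝ)
    {k : ℕ} (hk : 3 ≤ k) (t : Fin (n ^ k) → ℝ) : Prop :=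
  castVec (dim_L n hk) ((lyap k (S.A + S.B * S.Bᵀ * V₂))ᵀ *ᵥ t) =
    -termF S v k - (1 / 4 : ℝ) • termB S v k + η • termH S k - (1 / 4 : ℝ) • termG S v k

/-- `t` solves the linear system of degree `k` for the future energy function:
`𝓛ₖ(A - η B Bᵀ W₂)ᵀ t = -∑ 𝓛ᵢ(F_p)ᵀ wᵢ + (η/4) ∑ ij vec[Wᵢᵀ B Bᵀ Wⱼ] - ∑ vec[H_pᵀ H_q]
  + (η/4) ∑ ∑ ∑ ⋯`. -/
def SolvesFutureSystem (η : ℝ) (W₂ : Matrix (Fin n) (Fin n) ℝ) (w : (i : ℕ) → Fin (n ^ i) → ℝ)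
    {k : ℕ} (hk : 3 ≤ k) (t : Fin (n ^ k) → ℝ) : Prop :=
  castVec (dim_L n hk) ((lyap k (S.A - η • (S.B * S.Bᵀ * W₂)))ᵀ *ᵥ t) =
    -termF S w k + (η / 4 : ℝ) • termB S w k - termH S k + (η / 4 : ℝ) • termG S w k

end LinearSystems

end NLBalancing

end

open NLBalancing

namespace NLBalancing

/-! ### Spectra of Kronecker sums -/

/-! The eigenvalues of `𝓛ₖ(M)` are sums of `k` eigenvalues of `M`. If `M` or `-M` is Hurwitz and `k
≥ 1`, none of these sums vanishes, so the system has one solution for every right-hand side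
(`re_spectrum_lyapSq`, `existsUnique_lyap`). What has to be shown is that `-(A + B Bᵀ V₂)` and `A -
η B Bᵀ W₂` are Hurwitz.

These are the linearizations at `0` of the two asymptotically stable vector fields. Stability gives
only `Re μ ≤ 0`: an eigenvalue with positive real part would yield a quadratic Chetaev function
(`AsymptoticallyStable.re_spectrum_le`). A nonlinear equilibrium can be asymptotically stable with
imaginary eigenvalues in its linearization, so these need another argument.

That argument uses `γ > γ₀`. The quadratic parts of the two HJB equations say that `Q = V₂` and `Q =
-η W₂` satisfy one and the same Riccati equation `QA + AᵀQ + Q B Bᵀ Q = η CᵀC`. If `(A + B Bᵀ Q) z =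
iθ z`, put `u = BᵀQz`; the equation gives `|u|² = -η |Cz|²`. Feed the disturbance `(w₁, w₂) = (u,
-Cz)` at frequency `θ` into an admissible closed loop. The controller measures `Cz + w₂ = 0` and can
stay at rest, the plant state is `z`, and the output is `(Cz, 0)`, while `|w|² = (1 - η)|Cz|² =
γ⁻²|Cz|²`. A gain below `γ` forces `Cz = 0`, hence `u = 0`, and then `(z, 0)` is an undamped mode of
an internally stable loop, so `z = 0` (`eq_zero_of_mem_admissibleLevels`,
`re_spectrum_ne_zero_of_riccati`). -/

theorem mem_spectrum_iff_exists_mulVec {ι K : Type*} [Fintype ι] [DecidableEq ι] [Field K]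
    {M : Matrix ι ι K} {μ : K} : μ ∈ spectrum K M ↔ ∃ v, v ≠ 0 ∧ M *ᵥ v = μ • v := by
  rw [← spectrum_toLin', ← Module.End.hasEigenvalue_iff_mem_spectrum]
  constructor
  · intro h
    obtain ⟨v, hv⟩ := h.exists_hasEigenvector
    exact ⟨v, hv.2, by simpa using hv.apply_eq_smul⟩
  · rintro ⟨v, hv, h⟩
    exact Module.End.hasEigenvalue_of_hasEigenvector
      ⟨Module.End.mem_eigenspace_iff.2 (by simpa using h), hv⟩

/-- Since `g` commutes with `f + g`, it preserves the `μ`-eigenspace of `f + g` and has an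
eigenvector there; on that vector `f` acts as `μ - β`. -/
theorem exists_hasEigenvalue_of_commute_add {V : Type*} [AddCommGroup V] [Module ℂ V]
    [FiniteDimensional ℂ V] {f g : Module.End ℂ V} (hfg : Commute f g) {μ : ℂ}
    (h : (f + g).HasEigenvalue μ) :
    ∃ α β, f.HasEigenvalue α ∧ g.HasEigenvalue β ∧ μ = α + β := by
  have hc : Commute (f + g) g := hfg.add_left (Commute.refl g)
  have hm : ∀ x ∈ (f + g).eigenspace μ, g x ∈ (f + g).eigenspace μ :=
    Module.End.mapsTo_genEigenspace_of_comm hc μ 1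
  have : Nontrivial ((f + g).eigenspace μ) := Submodule.nontrivial_iff_ne_bot.2 h
  obtain ⟨β, hβ⟩ := Module.End.exists_eigenvalue (g.restrict hm)
  obtain ⟨w, hw⟩ := hβ.exists_hasEigenvector
  have hgw : g w = β • (w : V) := by simpa using congrArg Subtype.val hw.apply_eq_smul
  have hw0 : (w : V) ≠ 0 := fun h => hw.2 (Subtype.ext h)
  have hfw : f w + g w = μ • (w : V) := by
    simpa using Module.End.mem_eigenspace_iff.1 w.2
  refine ⟨μ - β, β, ?_, ?_, by ring⟩
  · refine Module.End.hasEigenvalue_of_hasEigenvector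
      (x := (w : V)) ⟨Module.End.mem_eigenspace_iff.2 ?_, hw0⟩
    rw [sub_smul, ← hfw, hgw, add_sub_cancel_right]
  · exact Module.End.hasEigenvalue_of_hasEigenvector
      (x := (w : V)) ⟨Module.End.mem_eigenspace_iff.2 hgw, hw0⟩

theorem exists_mem_spectrum_of_commute_add {ι : Type*} [Fintype ι] [DecidableEq ι]
    {X Y : Matrix ι ι ℂ} (h : Commute X Y) {μ : ℂ} (hμ : μ ∈ spectrum ℂ (X + Y)) :
    ∃ α ∈ spectrum ℂ X, ∃ β ∈ spectrum ℂ Y, μ = α + β := by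
  have hc : Commute (toLin' X) (toLin' Y) := h.map (toLinAlgEquiv' (R := ℂ) (n := ι))
  rw [← spectrum_toLin', ← Module.End.hasEigenvalue_iff_mem_spectrum, map_add] at hμ
  obtain ⟨α, β, hα, hβ, e⟩ := exists_hasEigenvalue_of_commute_add hc hμ
  rw [Module.End.hasEigenvalue_iff_mem_spectrum, spectrum_toLin'] at hα hβ
  exact ⟨α, hα, β, hβ, e⟩

section KroneckerSum

variable {ι κ : Type*} [Fintype ι] [DecidableEq ι] [Fintype κ] [DecidableEq κ]

/-- A nonzero slice `v (·, j)` of an eigenvector is an eigenvector of `X`. -/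
theorem spectrum_kronecker_one_subset (X : Matrix ι ι ℂ) :
    spectrum ℂ (X ⊗ₖ (1 : Matrix κ κ ℂ)) ⊆ spectrum ℂ X := by
  intro μ hμ
  obtain ⟨v, hv, e⟩ := mem_spectrum_iff_exists_mulVec.1 hμ
  obtain ⟨⟨i, j⟩, hij⟩ := Function.ne_iff.1 hv
  refine mem_spectrum_iff_exists_mulVec.2 ⟨fun i => v (i, j), fun h => hij (congrFun h i), ?_⟩
  funext a
  have := congrFun e (a, j)
  simpa [mulVec, dotProduct, Fintype.sum_prod_type, one_apply] using this

theorem spectrum_one_kronecker_subset (Y : Matrix κ κ ℂ) :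
    spectrum ℂ ((1 : Matrix ι ι ℂ) ⊗ₖ Y) ⊆ spectrum ℂ Y := by
  intro μ hμ
  obtain ⟨v, hv, e⟩ := mem_spectrum_iff_exists_mulVec.1 hμ
  obtain ⟨⟨i, j⟩, hij⟩ := Function.ne_iff.1 hv
  refine mem_spectrum_iff_exists_mulVec.2 ⟨fun j => v (i, j), fun h => hij (congrFun h j), ?_⟩
  funext a
  have := congrFun e (i, a)
  simpa [mulVec, dotProduct, Fintype.sum_prod_type, one_apply] using this

theorem exists_mem_spectrum_of_kronecker_sum {X : Matrix ι ι ℂ} {Y : Matrix κ κ ℂ} {μ : ℂ}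
    (hμ : μ ∈ spectrum ℂ (X ⊗ₖ (1 : Matrix κ κ ℂ) + (1 : Matrix ι ι ℂ) ⊗ₖ Y)) :
    ∃ α ∈ spectrum ℂ X, ∃ β ∈ spectrum ℂ Y, μ = α + β := by
  have hc : Commute (X ⊗ₖ (1 : Matrix κ κ ℂ)) ((1 : Matrix ι ι ℂ) ⊗ₖ Y) := by
    rw [commute_iff_eq, ← mul_kronecker_mul, ← mul_kronecker_mul]
    simp
  obtain ⟨α, hα, β, hβ, e⟩ := exists_mem_spectrum_of_commute_add hc hμ
  exact ⟨α, spectrum_kronecker_one_subset X hα, β, spectrum_one_kronecker_subset Y hβ, e⟩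

theorem spectrum_transpose_eq (X : Matrix ι ι ℂ) : spectrum ℂ Xᵀ = spectrum ℂ X := by
  ext μ
  rw [mem_spectrum_iff_isRoot_charpoly, mem_spectrum_iff_isRoot_charpoly, charpoly_transpose]

theorem isUnit_of_isUnit_map_ofReal {M : Matrix ι ι ℝ}
    (h : (0 : ℂ) ∉ spectrum ℂ (M.map (fun a : ℝ => (a : ℂ)))) : IsUnit M := by
  rw [spectrum.zero_mem_iff, not_not, isUnit_iff_isUnit_det, isUnit_iff_ne_zero] at h
  rw [isUnit_iff_isUnit_det, isUnit_iff_ne_zero]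
  intro h0
  apply h
  have := RingHom.map_det Complex.ofRealHom M
  rw [h0, map_zero] at this
  exact this.symm

theorem map_ofReal_one {ι : Type*} [DecidableEq ι] :
    (1 : Matrix ι ι ℝ).map (fun a : ℝ => (a : ℂ)) = 1 :=
  Matrix.map_one _ Complex.ofReal_zero Complex.ofReal_one

theorem map_ofReal_add {ι κ : Type*} (M N : Matrix ι κ ℝ) :
    (M + N).map (fun a : ℝ => (a : ℂ)) =
      M.map (fun a : ℝ => (a : ℂ)) + N.map (fun a : ℝ => (a : ℂ)) :=
  Matrix.map_add _ Complex.ofReal_add M N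

theorem map_ofReal_kronecker {l m p q : Type*} (M : Matrix l m ℝ) (N : Matrix p q ℝ) :
    (M ⊗ₖ N).map (fun a : ℝ => (a : ℂ)) =
      M.map (fun a : ℝ => (a : ℂ)) ⊗ₖ N.map (fun a : ℝ => (a : ℂ)) := by
  ext i j
  simp

/-- Under `vec`, the map `P ↦ P N + Nᵀ P` becomes a Kronecker sum whose eigenvalues are sums of two
eigenvalues of `N`. The solution `P` supplies the Chetaev function used below. -/
theorem exists_lyapunov_solution {N : Matrix ι ι ℝ}
    (h : ∀ α ∈ spectrum ℂ (N.map (fun a : ℝ => (a : ℂ))),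
      ∀ β ∈ spectrum ℂ (N.map (fun a : ℝ => (a : ℂ))), α + β ≠ 0) :
    ∃ P : Matrix ι ι ℝ, P * N + Nᵀ * P = 1 := by
  have hu : IsUnit (Nᵀ ⊗ₖ (1 : Matrix ι ι ℝ) + (1 : Matrix ι ι ℝ) ⊗ₖ Nᵀ) := by
    apply isUnit_of_isUnit_map_ofReal
    intro h0
    rw [map_ofReal_add, map_ofReal_kronecker, map_ofReal_kronecker, map_ofReal_one] at h0
    obtain ⟨α, hα, β, hβ, e⟩ := exists_mem_spectrum_of_kronecker_sum h0
    rw [transpose_map, spectrum_transpose_eq] at hα hβ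
    exact h α hα β hβ e.symm
  obtain ⟨p, hp⟩ := mulVec_surjective_iff_isUnit.2 hu (vec 1)
  refine ⟨of fun i j => p (j, i), ?_⟩
  have e : p = vec (of fun i j => p (j, i)) := rfl
  rw [e, add_mulVec, kronecker_mulVec_vec, kronecker_mulVec_vec] at hp
  ext i j
  have := congrFun hp (j, i)
  simpa [vec] using this

end KroneckerSum

/-! ### The Lyapunov matrices of a Hurwitz matrix -/

theorem castMat_castMat {a b a' b' a'' b'' : ℕ} (h₁ : a = a') (h₂ : b = b') (h₁' : a' = a'')
    (h₂' : b' = b'') (X : Matrix (Fin a) (Fin b) ℝ) :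
    castMat h₁' h₂' (castMat h₁ h₂ X) = castMat (h₁.trans h₁') (h₂.trans h₂') X := rfl

theorem castMat_add {a b a' b' : ℕ} (h₁ : a = a') (h₂ : b = b') (X Y : Matrix (Fin a) (Fin b) ℝ) :
    castMat h₁ h₂ (X + Y) = castMat h₁ h₂ X + castMat h₁ h₂ Y := rfl

theorem castMat_sum {σ : Type*} {a b a' b' : ℕ} (h₁ : a = a') (h₂ : b = b') (s : Finset σ)
    (X : σ → Matrix (Fin a) (Fin b) ℝ) :
    castMat h₁ h₂ (∑ i ∈ s, X i) = ∑ i ∈ s, castMat h₁ h₂ (X i) := by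
  subst h₁ h₂; rfl

theorem sum_kron {σ : Type*} {a b c d : ℕ} (s : Finset σ) (X : σ → Matrix (Fin a) (Fin b) ℝ)
    (Y : Matrix (Fin c) (Fin d) ℝ) :
    kron (∑ i ∈ s, X i) Y = ∑ i ∈ s, kron (X i) Y := by
  ext i j
  simp [kron, Matrix.sum_apply, Finset.sum_mul]

theorem castMat_kron {a b a' b' c d : ℕ} (h₁ : a = a') (h₂ : b = b')
    (X : Matrix (Fin a) (Fin b) ℝ) (Y : Matrix (Fin c) (Fin d) ℝ) :
    kron (castMat h₁ h₂ X) Y = castMat (by rw [h₁]) (by rw [h₂]) (kron X Y) := by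
  subst h₁ h₂; rfl

theorem finProdFinEquiv_assoc {a c d : ℕ} (h : a * (c * d) = a * c * d) (i : Fin a) (j : Fin c)
    (l : Fin d) : Fin.cast h (finProdFinEquiv (i, finProdFinEquiv (j, l))) =
      finProdFinEquiv (finProdFinEquiv (i, j), l) := by
  apply Fin.ext
  simp only [Fin.val_cast, finProdFinEquiv_apply_val]
  ring

/-- Splits the last identity factor off a summand of the Lyapunov matrix, which is what the
recursion `lyapSq_succ` needs. -/
theorem kron_one_mul {a b c d N : ℕ} (X : Matrix (Fin a) (Fin b) ℝ) (hN : N = c * d) :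
    kron X (1 : Matrix (Fin N) (Fin N) ℝ) =
      castMat (by rw [hN, mul_assoc]) (by rw [hN, mul_assoc])
        (kron (kron X (1 : Matrix (Fin c) (Fin c) ℝ)) (1 : Matrix (Fin d) (Fin d) ℝ)) := by
  subst hN
  ext i j
  obtain ⟨⟨i₁, i'⟩, rfl⟩ := finProdFinEquiv.surjective i
  obtain ⟨⟨i₂, i₃⟩, rfl⟩ := finProdFinEquiv.surjective i'
  obtain ⟨⟨j₁, j'⟩, rfl⟩ := finProdFinEquiv.surjective j
  obtain ⟨⟨j₂, j₃⟩, rfl⟩ := finProdFinEquiv.surjective j'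
  simp only [castMat, submatrix_apply, finProdFinEquiv_assoc]
  simp only [kron, reindex_apply, submatrix_apply, Equiv.symm_apply_apply, kroneckerMap_apply,
    one_apply, EmbeddingLike.apply_eq_iff_eq, Prod.mk.injEq]
  by_cases h₂ : i₂ = j₂ <;> by_cases h₃ : i₃ = j₃ <;> simp [h₂, h₃]

theorem kron_one_one {a b N : ℕ} (X : Matrix (Fin a) (Fin b) ℝ) (hN : N = 1) :
    kron X (1 : Matrix (Fin N) (Fin N) ℝ) =
      castMat (by rw [hN, mul_one]) (by rw [hN, mul_one]) X := by
  subst hN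
  ext i j
  obtain ⟨⟨i₁, i₂⟩, rfl⟩ := finProdFinEquiv.surjective i
  obtain ⟨⟨j₁, j₂⟩, rfl⟩ := finProdFinEquiv.surjective j
  have hi : ∀ {a : ℕ} (h : a * 1 = a) (i₁ : Fin a) (i₂ : Fin 1),
      Fin.cast h (finProdFinEquiv (i₁, i₂)) = i₁ := by
    intro a h i₁ i₂
    apply Fin.ext
    simp [finProdFinEquiv_apply_val]
  simp only [castMat, submatrix_apply, hi]
  simp [kron, Subsingleton.elim i₂ j₂]

/-- The Lyapunov matrix of a square matrix, as a square matrix. -/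
noncomputable def lyapSq {n : ℕ} (k : ℕ) (M : Matrix (Fin n) (Fin n) ℝ) :
    Matrix (Fin (n ^ k)) (Fin (n ^ k)) ℝ :=
  ∑ s : Fin k, castMat (lyap_dim' n k s) (lyap_dim' n k s)
    (kron (kron (1 : Matrix (Fin (n ^ (s : ℕ))) (Fin (n ^ (s : ℕ))) ℝ) M)
      (1 : Matrix (Fin (n ^ (k - 1 - s))) (Fin (n ^ (k - 1 - s))) ℝ))

theorem castMat_lyap {n k : ℕ} (M : Matrix (Fin n) (Fin n) ℝ) (h : n ^ (k - 1) * n = n ^ k) :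
    castMat rfl h (lyap k M) = lyapSq k M := by
  rw [lyap, castMat_sum]; rfl

/-- In all summands but the last, the final tensor factor is an identity; in the last one it is `M`.
This makes `𝓛ₖ₊₁` a Kronecker sum, so spectra can be found by induction. -/
theorem lyapSq_succ {n : ℕ} (k : ℕ) (M : Matrix (Fin n) (Fin n) ℝ) :
    lyapSq (k + 1) M = castMat (pow_succ n k).symm (pow_succ n k).symm
      (kron (lyapSq k M) (1 : Matrix (Fin n) (Fin n) ℝ) +
        kron (1 : Matrix (Fin (n ^ k)) (Fin (n ^ k)) ℝ) M) := by
  rw [castMat_add, lyapSq, Fin.sum_univ_castSucc]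
  congr 1
  · rw [lyapSq, sum_kron, castMat_sum]
    refine Finset.sum_congr rfl fun s _ => ?_
    have hs : n ^ (k + 1 - 1 - (s : ℕ)) = n ^ (k - 1 - (s : ℕ)) * n := by
      rw [← pow_succ]; congr 1; omega
    rw [castMat_kron, castMat_castMat]
    simp only [Fin.val_castSucc]
    rw [kron_one_mul _ hs, castMat_castMat]
  · simp only [Fin.val_last]
    rw [kron_one_one _ (by simp), castMat_castMat]

theorem spectrum_castMat {a b : ℕ} (h : a = b) (M : Matrix (Fin a) (Fin a) ℝ) :
    spectrum ℂ ((castMat h h M).map (fun a : ℝ => (a : ℂ))) =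
      spectrum ℂ (M.map (fun a : ℝ => (a : ℂ))) := by
  subst h; rfl

theorem exists_mem_spectrum_of_kron_sum {a b : ℕ} {X : Matrix (Fin a) (Fin a) ℝ}
    {Y : Matrix (Fin b) (Fin b) ℝ} {μ : ℂ}
    (hμ : μ ∈ spectrum ℂ ((kron X (1 : Matrix (Fin b) (Fin b) ℝ) +
      kron (1 : Matrix (Fin a) (Fin a) ℝ) Y).map (fun a : ℝ => (a : ℂ)))) :
    ∃ α ∈ spectrum ℂ (X.map (fun a : ℝ => (a : ℂ))),
      ∃ β ∈ spectrum ℂ (Y.map (fun a : ℝ => (a : ℂ))), μ = α + β := by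
  have e : (kron X (1 : Matrix (Fin b) (Fin b) ℝ) +
      kron (1 : Matrix (Fin a) (Fin a) ℝ) Y).map (fun a : ℝ => (a : ℂ)) =
      reindexAlgEquiv ℂ ℂ finProdFinEquiv
        (X.map (fun a : ℝ => (a : ℂ)) ⊗ₖ (1 : Matrix (Fin b) (Fin b) ℂ) +
          (1 : Matrix (Fin a) (Fin a) ℂ) ⊗ₖ Y.map (fun a : ℝ => (a : ℂ))) := by
    rw [← map_ofReal_one, ← map_ofReal_one, ← map_ofReal_kronecker, ← map_ofReal_kronecker,
      ← map_ofReal_add]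
    rfl
  rw [e, AlgEquiv.spectrum_eq] at hμ
  exact exists_mem_spectrum_of_kronecker_sum hμ

/-- The weak inequality lets the induction start at `k = 0`, where the matrix is zero; each step
adds one eigenvalue of `M` and makes it strict. -/
theorem re_spectrum_lyapSq {n : ℕ} {M : Matrix (Fin n) (Fin n) ℝ} (hM : IsHurwitz M) (k : ℕ) :
    ∀ μ ∈ spectrum ℂ ((lyapSq k M).map (fun a : ℝ => (a : ℂ))),
      μ.re ≤ 0 ∧ (k ≠ 0 → μ.re < 0) := by
  induction k with
  | zero =>
    intro μ hμ
    obtain ⟨v, hv, e⟩ := mem_spectrum_iff_exists_mulVec.1 hμ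
    have h0 : (lyapSq 0 M).map (fun a : ℝ => (a : ℂ)) = 0 := by
      rw [show lyapSq 0 M = 0 from Finset.sum_empty]; exact Matrix.map_zero _ Complex.ofReal_zero
    rw [h0, zero_mulVec] at e
    have : μ = 0 := (smul_eq_zero.1 e.symm).resolve_right hv
    simp [this]
  | succ k ih =>
    intro μ hμ
    rw [lyapSq_succ, spectrum_castMat] at hμ
    obtain ⟨α, hα, β, hβ, rfl⟩ := exists_mem_spectrum_of_kron_sum hμ
    have h₁ := (ih α hα).1
    have h₂ := hM β hβ
    rw [Complex.add_re]
    exact ⟨by linarith, fun _ => by linarith⟩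

theorem IsHurwitz.isUnit_lyapSq {n : ℕ} {M : Matrix (Fin n) (Fin n) ℝ} (hM : IsHurwitz M) {k : ℕ}
    (hk : k ≠ 0) : IsUnit (lyapSq k M) :=
  isUnit_of_isUnit_map_ofReal fun h => by
    simpa using (re_spectrum_lyapSq hM k 0 h).2 hk

theorem lyapSq_neg {n : ℕ} (k : ℕ) (M : Matrix (Fin n) (Fin n) ℝ) :
    lyapSq k (-M) = -lyapSq k M := by
  rw [lyapSq, lyapSq, ← Finset.sum_neg_distrib]
  refine Finset.sum_congr rfl fun s _ => ?_
  ext i j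
  simp [castMat, kron]

theorem castVec_mulVec {a b N : ℕ} (h : a = b) (X : Matrix (Fin a) (Fin N) ℝ) (t : Fin N → ℝ) :
    castVec h (X *ᵥ t) = castMat h rfl X *ᵥ t := rfl

theorem existsUnique_lyap {n k : ℕ} {M : Matrix (Fin n) (Fin n) ℝ} (hM : IsUnit (lyapSq k M))
    (h : n ^ (k - 1) * n = n ^ k) (b : Fin (n ^ k) → ℝ) :
    ∃! t : Fin (n ^ k) → ℝ, castVec h ((lyap k M)ᵀ *ᵥ t) = b := by
  have e : castMat h rfl (lyap k M)ᵀ = (lyapSq k M)ᵀ := by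
    rw [← castMat_lyap M h]; rfl
  simp only [castVec_mulVec, e]
  have hu : IsUnit (lyapSq k M)ᵀ := by
    rwa [isUnit_iff_isUnit_det, det_transpose, ← isUnit_iff_isUnit_det]
  exact (show Function.Bijective (lyapSq k M)ᵀ.mulVec from
    ⟨mulVec_injective_iff_isUnit.2 hu, mulVec_surjective_iff_isUnit.2 hu⟩).existsUnique b

end NLBalancing

namespace NLBalancing

/-! ### The linearization at an asymptotically stable equilibrium -/

theorem exists_re_im_eigenvector {ι : Type*} [Fintype ι] [DecidableEq ι] {M : Matrix ι ι ℝ} {μ : ℂ}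
    (hμ : μ ∈ spectrum ℂ (M.map (fun a : ℝ => (a : ℂ)))) :
    ∃ p q : ι → ℝ, (p ≠ 0 ∨ q ≠ 0) ∧ M *ᵥ p = μ.re • p - μ.im • q ∧
      M *ᵥ q = μ.im • p + μ.re • q := by
  obtain ⟨z, hz, e⟩ := mem_spectrum_iff_exists_mulVec.1 hμ
  refine ⟨fun i => (z i).re, fun i => (z i).im, ?_, ?_, ?_⟩
  · by_contra! h
    exact hz (funext fun i => Complex.ext (congrFun h.1 i) (congrFun h.2 i))
  · funext i
    have := congrArg Complex.re (congrFun e i)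
    simpa [mulVec, dotProduct] using this
  · funext i
    have := congrArg Complex.im (congrFun e i)
    simp only [mulVec, dotProduct, map_apply, Complex.im_sum, Complex.mul_im, Complex.ofReal_re,
      Complex.ofReal_im, zero_mul, add_zero, Pi.smul_apply, smul_eq_mul, Pi.add_apply] at this ⊢
    rw [this]; ring

/-- A Chetaev function for the linear part excludes stability. -/
theorem not_stable_of_quadratic {E : Type*} [NormedAddCommGroup E] [InnerProductSpace ℝ E]
    {X : E → E} {L P : E →L[ℝ] E} {a : ℝ} (ha : 0 < a) (hX : HasFDerivAt X L 0) (hX0 : X 0 = 0)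
    (hP : ∀ x, inner ℝ x (P (L x)) + inner ℝ (L x) (P x) = ‖x‖ ^ 2 + 2 * a * inner ℝ x (P x))
    {y : E} (hy : 0 < inner ℝ y (P y)) :
    ∃ ε > 0, ∀ δ > 0, ∃ x₀, ‖x₀‖ < δ ∧ ∀ x : ℝ → E,
      (∀ t, 0 ≤ t → HasDerivWithinAt x (X (x t)) (Set.Ici 0) t) → x 0 = x₀ →
        ¬ ∀ t, 0 ≤ t → ‖x t‖ < ε := by
  -- With this bound on the remainder `X x - L x`, the error in the derivative of `⟨x, P x⟩` is at
  -- most `‖x‖²`, exactly the surplus in `hP`; the `+ 1` allows `P = 0`.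
  have hc : 0 < 1 / (2 * ‖P‖ + 1) := by positivity
  have ho := hX.isLittleO.def hc
  simp only [hX0, sub_zero] at ho
  obtain ⟨ε, hε, hball⟩ := Metric.eventually_nhds_iff.1 ho
  have hgrow : ∀ x, ‖x‖ < ε →
      2 * a * inner ℝ x (P x) ≤ inner ℝ x (P (X x)) + inner ℝ (X x) (P x) := by
    intro x hx
    have h₁ := hball (y := x) (by simpa using hx)
    have h₂ : inner ℝ x (P (X x)) + inner ℝ (X x) (P x) =
        (inner ℝ x (P (L x)) + inner ℝ (L x) (P x)) +
          (inner ℝ x (P (X x - L x)) + inner ℝ (X x - L x) (P x)) := by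
      simp only [map_sub, inner_sub_left, inner_sub_right]; ring
    have h₃ : |inner ℝ x (P (X x - L x))| ≤ ‖x‖ * (‖P‖ * ‖X x - L x‖) :=
      (abs_real_inner_le_norm _ _).trans (by gcongr; exact P.le_opNorm _)
    have h₄ : |inner ℝ (X x - L x) (P x)| ≤ ‖X x - L x‖ * (‖P‖ * ‖x‖) :=
      (abs_real_inner_le_norm _ _).trans (by gcongr; exact P.le_opNorm _)
    have h₅ : 2 * ‖P‖ * ‖x‖ * ‖X x - L x‖ ≤ ‖x‖ ^ 2 := by
      calc 2 * ‖P‖ * ‖x‖ * ‖X x - L x‖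
          ≤ 2 * ‖P‖ * ‖x‖ * (1 / (2 * ‖P‖ + 1) * ‖x‖) := by gcongr
        _ = 2 * ‖P‖ / (2 * ‖P‖ + 1) * ‖x‖ ^ 2 := by ring
        _ ≤ 1 * ‖x‖ ^ 2 := by
            gcongr
            rw [div_le_one (by positivity)]; linarith
        _ = ‖x‖ ^ 2 := one_mul _
    rw [h₂, hP]
    have := (abs_le.1 h₃).1
    have := (abs_le.1 h₄).1
    linarith
  refine ⟨ε, hε, fun δ hδ => ?_⟩
  have hy0 : 0 < ‖y‖ := by
    rw [norm_pos_iff]; rintro rfl; simp at hy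
  -- A multiple of `y` of norm `δ / 2`: the form stays positive under scaling.
  refine ⟨(δ / (2 * ‖y‖)) • y, ?_, ?_⟩
  · rw [norm_smul, Real.norm_of_nonneg (by positivity)]
    field_simp
    linarith
  intro x hx hx0 hb
  set Q : ℝ → ℝ := fun t => inner ℝ (x t) (P (x t)) with hQ
  have hQ0 : 0 < Q 0 := by
    simp only [hQ, hx0, map_smul, inner_smul_left, inner_smul_right]
    have : 0 < δ / (2 * ‖y‖) := by positivity
    simp only [conj_trivial]
    positivity
  have hd : ∀ t, 0 ≤ t → HasDerivWithinAt (fun t => Q t * Real.exp (-(2 * a) * t))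
      ((inner ℝ (x t) (P (X (x t))) + inner ℝ (X (x t)) (P (x t))) * Real.exp (-(2 * a) * t) +
        Q t * (Real.exp (-(2 * a) * t) * (-(2 * a) * 1))) (Set.Ici 0) t := by
    intro t ht
    have h₁ := hx t ht
    have h₂ : HasDerivWithinAt (fun t => P (x t)) (P (X (x t))) (Set.Ici 0) t :=
      P.hasFDerivAt.comp_hasDerivWithinAt t h₁
    exact (h₁.inner ℝ h₂).mul (((hasDerivWithinAt_id t _).const_mul _).exp)
  -- Integrates `Q' ≥ 2aQ`: exponential growth of `Q` contradicts `Q ≤ ‖P‖ ε²`.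
  have hmono : MonotoneOn (fun t => Q t * Real.exp (-(2 * a) * t)) (Set.Ici 0) := by
    refine monotoneOn_of_hasDerivWithinAt_nonneg (convex_Ici 0)
      (fun t ht => (hd t ht).continuousWithinAt)
      (fun t ht => (hd t (interior_subset ht)).mono interior_subset) fun t ht => ?_
    have ht : 0 ≤ t := interior_subset ht
    have := hgrow _ (hb t ht)
    have : 0 ≤ ((inner ℝ (x t) (P (X (x t))) + inner ℝ (X (x t)) (P (x t))) - 2 * a * Q t) *
        Real.exp (-(2 * a) * t) := mul_nonneg (by simp only [hQ]; linarith) (Real.exp_pos _).le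
    linarith
  have hle : ∀ t, 0 ≤ t → Q 0 * Real.exp (2 * a * t) ≤ ‖P‖ * ε ^ 2 := by
    intro t ht
    have h₁ := hmono (Set.mem_Ici.2 le_rfl) (Set.mem_Ici.2 ht) ht
    simp only [mul_zero, Real.exp_zero, mul_one, neg_mul, Real.exp_neg] at h₁
    rw [← div_eq_mul_inv, le_div_iff₀ (Real.exp_pos _)] at h₁
    refine h₁.trans ((le_abs_self _).trans ((abs_real_inner_le_norm _ _).trans ?_))
    calc ‖x t‖ * ‖P (x t)‖ ≤ ‖x t‖ * (‖P‖ * ‖x t‖) := by gcongr; exact P.le_opNorm _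
      _ = ‖P‖ * ‖x t‖ ^ 2 := by ring
      _ ≤ ‖P‖ * ε ^ 2 := by gcongr; exact (hb t ht).le
  have ht : Tendsto (fun t => Q 0 * Real.exp (2 * a * t)) atTop atTop :=
    (Real.tendsto_exp_atTop.comp (tendsto_id.const_mul_atTop (by positivity))).const_mul_atTop hQ0
  obtain ⟨t, h₁, h₂⟩ := ((ht.eventually_gt_atTop (‖P‖ * ε ^ 2)).and (eventually_ge_atTop 0)).exists
  exact absurd (hle t h₂) (not_le.2 h₁)

theorem inner_toEuclideanCLM {n : ℕ} (P : Matrix (Fin n) (Fin n) ℝ)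
    (x y : EuclideanSpace ℝ (Fin n)) :
    inner ℝ x (toEuclideanCLM (𝕜 := ℝ) P y) = x.ofLp ⬝ᵥ (P *ᵥ y.ofLp) := by
  rw [EuclideanSpace.inner_eq_star_dotProduct, ofLp_toEuclideanCLM, star_trivial, dotProduct_comm]

theorem spectrum_sub_smul_one {ι : Type*} [Fintype ι] [DecidableEq ι] (L : Matrix ι ι ℝ) (a : ℝ)
    {α : ℂ} : α ∈ spectrum ℂ ((L - a • (1 : Matrix ι ι ℝ)).map (fun a : ℝ => (a : ℂ))) ↔
      α + a ∈ spectrum ℂ (L.map (fun a : ℝ => (a : ℂ))) := by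
  have e : (L - a • (1 : Matrix ι ι ℝ)).map (fun a : ℝ => (a : ℂ)) =
      L.map (fun a : ℝ => (a : ℂ)) - (a : ℂ) • 1 := by
    ext i j
    simp only [map_apply, Matrix.sub_apply, Matrix.smul_apply, one_apply, smul_eq_mul]
    split_ifs <;> simp
  simp only [mem_spectrum_iff_exists_mulVec, e, sub_mulVec, smul_mulVec, one_mulVec, add_smul,
    sub_eq_iff_eq_add]

/-- For `0 < a < Re μ` the shifted matrix `L - a` still has an eigenvalue with positive real part,
and the Lyapunov solution `P` for it satisfies the hypothesis of `not_stable_of_quadratic`. -/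
theorem AsymptoticallyStable.re_spectrum_le {n : ℕ}
    {X : EuclideanSpace ℝ (Fin n) → EuclideanSpace ℝ (Fin n)} {L : Matrix (Fin n) (Fin n) ℝ}
    (h : AsymptoticallyStable X) (hX : HasFDerivAt X (toEuclideanCLM (𝕜 := ℝ) L) 0)
    (hX0 : X 0 = 0) : ∀ μ ∈ spectrum ℂ (L.map (fun a : ℝ => (a : ℂ))), μ.re ≤ 0 := by
  intro μ hμ
  by_contra! hpos
  set σ := spectrum ℂ (L.map (fun a : ℝ => (a : ℂ))) with hσ
  -- The shifts to avoid: two eigenvalues of `L - a` sum to zero only if `a` is half the real part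
  -- of a sum of two eigenvalues of `L`.
  have hfin : ((fun p : ℂ × ℂ => (p.1 + p.2).re / 2) '' (σ ×ˢ σ)).Finite :=
    ((finite_spectrum _).prod (finite_spectrum _)).image _
  obtain ⟨a, ⟨ha0, haμ⟩, ha⟩ := ((Set.Ioo_infinite hpos).sdiff hfin).nonempty
  set N := L - a • (1 : Matrix (Fin n) (Fin n) ℝ) with hN
  obtain ⟨P, hP⟩ : ∃ P : Matrix (Fin n) (Fin n) ℝ, P * N + Nᵀ * P = 1 := by
    apply exists_lyapunov_solution
    intro α hα β hβ e
    rw [hN, spectrum_sub_smul_one] at hα hβ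
    refine ha ⟨(α + a, β + a), ⟨hα, hβ⟩, ?_⟩
    have : α + a + (β + a) = 2 * a := by linear_combination e
    simp [this]
  have hquad : ∀ x : Fin n → ℝ, x ⬝ᵥ (P *ᵥ (N *ᵥ x)) + (N *ᵥ x) ⬝ᵥ (P *ᵥ x) = x ⬝ᵥ x := by
    intro x
    have := congrArg (fun M => x ⬝ᵥ (M *ᵥ x)) hP
    simpa only [add_mulVec, dotProduct_add, ← mulVec_mulVec, one_mulVec, dotProduct_mulVec x Nᵀ,
      vecMul_transpose] using this
  -- Adding the Lyapunov identity over the real and imaginary parts `p`, `q` of the unstable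
  -- eigenvector cancels the cross terms, so the form is positive at `p` or at `q`.
  have hpoint : ∃ y : Fin n → ℝ, 0 < y ⬝ᵥ (P *ᵥ y) := by
    have hev : μ - a ∈ spectrum ℂ (N.map (fun a : ℝ => (a : ℂ))) := by
      rw [hN, spectrum_sub_smul_one]; simpa using hμ
    obtain ⟨p, q, hpq, hp, hq⟩ := exists_re_im_eigenvector hev
    by_contra! hneg
    have h₁ := hquad p
    have h₂ := hquad q
    rw [hp] at h₁
    rw [hq] at h₂
    simp only [mulVec_add, mulVec_sub, mulVec_smul, dotProduct_add, dotProduct_sub, dotProduct_smul,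
      add_dotProduct, sub_dotProduct, smul_dotProduct, smul_eq_mul, Complex.sub_re,
      Complex.ofReal_re] at h₁ h₂
    have hpp : 0 ≤ p ⬝ᵥ p := Finset.sum_nonneg fun i _ => mul_self_nonneg _
    have hqq : 0 ≤ q ⬝ᵥ q := Finset.sum_nonneg fun i _ => mul_self_nonneg _
    have hsum : 2 * (μ.re - a) * (p ⬝ᵥ (P *ᵥ p) + q ⬝ᵥ (P *ᵥ q)) = p ⬝ᵥ p + q ⬝ᵥ q := by
      linear_combination h₁ + h₂
    have hle : 2 * (μ.re - a) * (p ⬝ᵥ (P *ᵥ p) + q ⬝ᵥ (P *ᵥ q)) ≤ 0 :=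
      mul_nonpos_of_nonneg_of_nonpos (by linarith) (by linarith [hneg p, hneg q])
    rcases hpq with h | h
    · exact h (dotProduct_self_eq_zero.1 (by linarith))
    · exact h (dotProduct_self_eq_zero.1 (by linarith))
  obtain ⟨y, hy⟩ := hpoint
  obtain ⟨ε, hε, hun⟩ := not_stable_of_quadratic (P := toEuclideanCLM (𝕜 := ℝ) P)
    (y := WithLp.toLp 2 y) ha0 hX hX0 (fun x => by
      have := hquad x.ofLp
      rw [hN] at this
      simp only [sub_mulVec, smul_mulVec, one_mulVec, mulVec_sub, mulVec_smul, dotProduct_sub,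
        sub_dotProduct, dotProduct_smul, smul_dotProduct, smul_eq_mul] at this
      rw [inner_toEuclideanCLM, inner_toEuclideanCLM, inner_toEuclideanCLM, ofLp_toEuclideanCLM,
        ← real_inner_self_eq_norm_sq, EuclideanSpace.inner_eq_star_dotProduct, star_trivial]
      linarith) (by rw [inner_toEuclideanCLM]; exact hy)
  obtain ⟨δ, hδ, hst⟩ := h.stable ε hε
  obtain ⟨x₀, hx₀, hno⟩ := hun δ hδ
  obtain ⟨⟨x, hx, hx0⟩, hall⟩ := hst x₀ hx₀
  exact hno x hx hx0 (hall x hx hx0)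

end NLBalancing

namespace NLBalancing

/-! ### Admissible performance levels -/

theorem map_ofReal_mul {ι κ ν : Type*} [Fintype κ] (M : Matrix ι κ ℝ) (N : Matrix κ ν ℝ) :
    (M * N).map (fun a : ℝ => (a : ℂ)) =
      M.map (fun a : ℝ => (a : ℂ)) * N.map (fun a : ℝ => (a : ℂ)) := by
  ext i j
  simp [mul_apply]

theorem map_ofReal_zero {ι κ : Type*} :
    (0 : Matrix ι κ ℝ).map (fun a : ℝ => (a : ℂ)) = 0 :=
  Matrix.map_zero _ Complex.ofReal_zero

-- The hypothesis `hx` describes a sinusoidal steady state, so the output is the transfer matrix at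
-- `iθ` applied to `w`; the resolvent exists because `A` has no imaginary eigenvalue. The bound `N`
-- is the norm of that matrix.
open scoped Matrix.Norms.L2Operator in
theorem exists_norm_le_of_hinfNorm_lt {ι κ ν : Type*} [Fintype ι] [DecidableEq ι] [Fintype κ]
    [DecidableEq κ] [Fintype ν] [DecidableEq ν] {A : Matrix ι ι ℝ} {B : Matrix ι κ ℝ}
    {C : Matrix ν ι ℝ} {D : Matrix ν κ ℝ} (hA : IsHurwitz A) {c : ℝ}
    (h : hinfNorm A B C D < ENNReal.ofReal c) {θ : ℝ} {x : ι → ℂ} {w : κ → ℂ}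
    (hx : A.map (fun a : ℝ => (a : ℂ)) *ᵥ x + B.map (fun a : ℝ => (a : ℂ)) *ᵥ w =
      (Complex.I * (θ : ℂ)) • x) :
    ∃ N : ℝ, 0 ≤ N ∧ N < c ∧
      ‖WithLp.toLp 2 (C.map (fun a : ℝ => (a : ℂ)) *ᵥ x + D.map (fun a : ℝ => (a : ℂ)) *ᵥ w)‖ ≤
        N * ‖WithLp.toLp 2 w‖ := by
  set s : ℂ := Complex.I * (θ : ℂ) with hs
  set R := s • (1 : Matrix ι ι ℂ) - A.map (fun a : ℝ => (a : ℂ)) with hR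
  have hsu : IsUnit R := by
    by_contra hn
    have : s ∈ spectrum ℂ (A.map (fun a : ℝ => (a : ℂ))) := by
      rw [spectrum.mem_iff, Algebra.algebraMap_eq_smul_one]; exact hn
    simpa [hs] using hA s this
  have hxw : x = R⁻¹ *ᵥ (B.map (fun a : ℝ => (a : ℂ)) *ᵥ w) := by
    have : R *ᵥ x = B.map (fun a : ℝ => (a : ℂ)) *ᵥ w := by
      rw [hR, sub_mulVec, smul_mulVec, one_mulVec, ← hx, add_sub_cancel_left]
    rw [← this, mulVec_mulVec, nonsing_inv_mul _ ((isUnit_iff_isUnit_det _).1 hsu), one_mulVec]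
  have hout : C.map (fun a : ℝ => (a : ℂ)) *ᵥ x + D.map (fun a : ℝ => (a : ℂ)) *ᵥ w =
      (C.map (fun a : ℝ => (a : ℂ)) * R⁻¹ * B.map (fun a : ℝ => (a : ℂ)) +
        D.map (fun a : ℝ => (a : ℂ))) *ᵥ w := by
    rw [hxw, add_mulVec, mulVec_mulVec, mulVec_mulVec, Matrix.mul_assoc]
  have hlt := (le_iSup_iff.2 fun _ hb => hb θ).trans_lt h
  refine ⟨_, norm_nonneg _, (ENNReal.ofReal_lt_ofReal_iff_of_nonneg (norm_nonneg _)).1 hlt, ?_⟩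
  · rw [hout]
    exact l2_opNorm_mulVec _ (WithLp.toLp 2 w)

theorem eq_zero_of_mem_admissibleLevels {n m r : ℕ} {A : Matrix (Fin n) (Fin n) ℝ}
    {B : Matrix (Fin n) (Fin m) ℝ} {C : Matrix (Fin r) (Fin n) ℝ} {c γ : ℝ}
    (hc : c ∈ admissibleLevels A B C) (hcγ : c < γ) {θ : ℝ} {z : Fin n → ℂ} {u : Fin m → ℂ}
    (hz : A.map (fun a : ℝ => (a : ℂ)) *ᵥ z + B.map (fun a : ℝ => (a : ℂ)) *ᵥ u =
      (Complex.I * (θ : ℂ)) • z)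
    (hu : ∑ i, ‖u i‖ ^ 2 =
      -(1 - γ ^ (-2 : ℤ)) * ∑ i, ‖(C.map (fun a : ℝ => (a : ℂ)) *ᵥ z) i‖ ^ 2) : z = 0 := by
  obtain ⟨s, K, hK, hn⟩ := hc
  set y := C.map (fun a : ℝ => (a : ℂ)) *ᵥ z with hy
  -- The measurement noise `-y` cancels the plant output, so the controller state `0` is consistent
  -- and the disturbance `u` alone drives the plant.
  have hx : (K.clA A B C).map (fun a : ℝ => (a : ℂ)) *ᵥ Sum.elim z 0 +
      (K.clB B).map (fun a : ℝ => (a : ℂ)) *ᵥ Sum.elim u (-y) =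
        (Complex.I * (θ : ℂ)) • Sum.elim z 0 := by
    rw [Controller.clA, Controller.clB, fromBlocks_map, fromBlocks_map, fromBlocks_mulVec,
      fromBlocks_mulVec]
    simp only [Sum.elim_comp_inl, Sum.elim_comp_inr, mulVec_zero, add_zero, map_ofReal_add,
      map_ofReal_mul, map_ofReal_zero, zero_mulVec, zero_add, mulVec_neg, add_mulVec,
      ← mulVec_mulVec, ← hy]
    funext i
    rcases i with i | i
    · have := congrFun hz i
      simp only [Pi.add_apply, Pi.smul_apply, Sum.elim_inl, Pi.neg_apply] at this ⊢
      rw [← this]; ring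
    · simp
  obtain ⟨N, hN0, hNc, hle⟩ := exists_norm_le_of_hinfNorm_lt hK hn hx
  have hout : (K.clC C).map (fun a : ℝ => (a : ℂ)) *ᵥ Sum.elim z 0 +
      (Controller.clD K : Matrix (Fin r ⊕ Fin m) (Fin m ⊕ Fin r) ℝ).map (fun a : ℝ => (a : ℂ)) *ᵥ
        Sum.elim u (-y) = Sum.elim y 0 := by
    rw [Controller.clC, Controller.clD, fromBlocks_map, fromBlocks_map, fromBlocks_mulVec,
      fromBlocks_mulVec]
    simp only [Sum.elim_comp_inl, Sum.elim_comp_inr, mulVec_zero, add_zero,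
      map_ofReal_mul, map_ofReal_zero, zero_mulVec, zero_add, mulVec_neg,
      ← mulVec_mulVec, ← hy]
    funext i
    rcases i with i | i <;> simp
  rw [hout] at hle
  have hsq := pow_le_pow_left₀ (norm_nonneg _) hle 2
  rw [mul_pow, EuclideanSpace.norm_sq_eq, EuclideanSpace.norm_sq_eq] at hsq
  simp only [Fintype.sum_sum_type, Sum.elim_inl, Sum.elim_inr, Pi.neg_apply, norm_neg,
    Pi.zero_apply, norm_zero, ne_eq, OfNat.ofNat_ne_zero, not_false_eq_true, zero_pow,
    Finset.sum_const_zero, add_zero, hu] at hsq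
  -- From `0 ≤ N < c < γ`.
  have hγ : 0 < γ := by linarith
  set Y := ∑ i, ‖y i‖ ^ 2 with hY
  have hY0 : 0 ≤ Y := by positivity
  have hsum : -(1 - γ ^ (-2 : ℤ)) * Y + Y = γ ^ (-2 : ℤ) * Y := by ring
  rw [hsum] at hsq
  have hYz : Y = 0 := by
    by_contra hne
    have hpos : 0 < Y := lt_of_le_of_ne hY0 (Ne.symm hne)
    have h₁ : N ^ 2 < γ ^ 2 := by gcongr; linarith
    have h₂ : N ^ 2 * (γ ^ (-2 : ℤ) * Y) < γ ^ 2 * (γ ^ (-2 : ℤ) * Y) :=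
      mul_lt_mul_of_pos_right h₁ (by positivity)
    have h₃ : γ ^ 2 * (γ ^ (-2 : ℤ) * Y) = Y := by
      rw [← mul_assoc, _root_.zpow_neg, zpow_ofNat, mul_inv_cancel₀ (by positivity), one_mul]
    linarith
  rw [hYz, mul_zero] at hu
  have hu0 : u = 0 := funext fun i => by
    have := (Finset.sum_eq_zero_iff_of_nonneg fun i _ => by positivity).1 hu i (Finset.mem_univ i)
    simpa using this
  have hy0 : y = 0 := funext fun i => by
    have := (Finset.sum_eq_zero_iff_of_nonneg fun i _ => by positivity).1 hYz i (Finset.mem_univ i)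
    simpa using this
  by_contra hne
  -- Without disturbance, `hx` makes `(z, 0)` an eigenvector of the closed loop for `iθ`.
  rw [hu0, hy0, neg_zero, Sum.elim_zero_zero, mulVec_zero, add_zero] at hx
  have hmem : Complex.I * (θ : ℂ) ∈ spectrum ℂ ((K.clA A B C).map (fun a : ℝ => (a : ℂ))) :=
    mem_spectrum_iff_exists_mulVec.2
      ⟨_, fun h => hne (funext fun i => by simpa using congrFun h (Sum.inl i)), hx⟩
  simpa using hK _ hmem

/-- A quadratic identity for the state feedback `u = B Bᵀ Q x` excludes imaginary eigenvalues of the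
closed loop. -/
theorem re_spectrum_ne_zero_of_riccati {n m r : ℕ} {A : Matrix (Fin n) (Fin n) ℝ}
    {B : Matrix (Fin n) (Fin m) ℝ} {C : Matrix (Fin r) (Fin n) ℝ} {c γ : ℝ}
    (hc : c ∈ admissibleLevels A B C) (hcγ : c < γ) {Q : Matrix (Fin n) (Fin n) ℝ} (hQ : Q.IsSymm)
    (hric : ∀ x : Fin n → ℝ, 2 * ((Q *ᵥ x) ⬝ᵥ (A *ᵥ x)) +
      (Bᵀ *ᵥ (Q *ᵥ x)) ⬝ᵥ (Bᵀ *ᵥ (Q *ᵥ x)) =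
        (1 - γ ^ (-2 : ℤ)) * ((C *ᵥ x) ⬝ᵥ (C *ᵥ x))) :
    ∀ μ ∈ spectrum ℂ ((A + B * Bᵀ * Q).map (fun a : ℝ => (a : ℂ))), μ.re ≠ 0 := by
  intro μ hμ hre
  obtain ⟨p, q, hpq, hp, hq⟩ := exists_re_im_eigenvector hμ
  simp only [hre, zero_smul, zero_sub, add_zero, add_mulVec, ← mulVec_mulVec] at hp hq
  set θ := μ.im
  set up := Bᵀ *ᵥ (Q *ᵥ p) with hup
  set uq := Bᵀ *ᵥ (Q *ᵥ q) with huq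
  have hB : ∀ x u, (Q *ᵥ x) ⬝ᵥ (B *ᵥ u) = (Bᵀ *ᵥ (Q *ᵥ x)) ⬝ᵥ u := fun x u => by
    rw [dotProduct_mulVec, mulVec_transpose]
  -- Symmetry of `Q` cancels the `θ` terms when the identities for `p` and `q` are added.
  have hsymm : (Q *ᵥ p) ⬝ᵥ q = (Q *ᵥ q) ⬝ᵥ p := by
    rw [dotProduct_comm, dotProduct_mulVec, ← mulVec_transpose, hQ.eq]
  have h₁ : (Q *ᵥ p) ⬝ᵥ (A *ᵥ p) + up ⬝ᵥ up = -(θ * ((Q *ᵥ p) ⬝ᵥ q)) := by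
    have := congrArg (fun x => (Q *ᵥ p) ⬝ᵥ x) hp
    simpa only [dotProduct_add, hB, dotProduct_neg, dotProduct_smul, smul_eq_mul] using this
  have h₂ : (Q *ᵥ q) ⬝ᵥ (A *ᵥ q) + uq ⬝ᵥ uq = θ * ((Q *ᵥ q) ⬝ᵥ p) := by
    have := congrArg (fun x => (Q *ᵥ q) ⬝ᵥ x) hq
    simpa only [dotProduct_add, hB, dotProduct_neg, dotProduct_smul, smul_eq_mul] using this
  have hsum : up ⬝ᵥ up + uq ⬝ᵥ uq =
      -(1 - γ ^ (-2 : ℤ)) * ((C *ᵥ p) ⬝ᵥ (C *ᵥ p) + (C *ᵥ q) ⬝ᵥ (C *ᵥ q)) := by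
    linear_combination 2 * h₁ + 2 * h₂ - hric p - hric q - 2 * θ * hsymm
  have hmap : ∀ {a b : ℕ} (M : Matrix (Fin a) (Fin b) ℝ) (x y : Fin b → ℝ),
      M.map (fun a : ℝ => (a : ℂ)) *ᵥ (fun i => ⟨x i, y i⟩) =
        fun i => (⟨(M *ᵥ x) i, (M *ᵥ y) i⟩ : ℂ) := by
    intro a b M x y
    funext i
    apply Complex.ext <;> simp [mulVec, dotProduct]
  have hnorm : ∀ {a : ℕ} (x y : Fin a → ℝ),
      ∑ i, ‖(⟨x i, y i⟩ : ℂ)‖ ^ 2 = x ⬝ᵥ x + y ⬝ᵥ y := by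
    intro a x y
    simp [Complex.sq_norm, Complex.normSq_apply, dotProduct, Finset.sum_add_distrib]
  have hz := eq_zero_of_mem_admissibleLevels hc hcγ (θ := θ) (z := fun i => ⟨p i, q i⟩)
    (u := fun i => ⟨up i, uq i⟩) (by
      rw [hmap, hmap]
      funext i
      have h₁ := congrFun hp i
      have h₂ := congrFun hq i
      simp only [Pi.add_apply, Pi.neg_apply, Pi.smul_apply, smul_eq_mul] at h₁ h₂ ⊢
      apply Complex.ext <;> simp <;> linarith) (by
      simp only [hmap, hnorm]
      exact hsum)
  rcases hpq with h | h
  · exact h (funext fun i => congrArg Complex.re (congrFun hz i))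
  · exact h (funext fun i => congrArg Complex.im (congrFun hz i))

end NLBalancing

namespace NLBalancing

/-! ### Second order behaviour of the energy functions -/

/-- Second order Taylor expansion shows that the Hessian form is `o(‖x‖²)`; being homogeneous of
degree two it vanishes, and polarization kills the Hessian. -/
theorem hasFDerivAt_fderiv_of_isLittleO_sq {E : Type*} [NormedAddCommGroup E] [NormedSpace ℝ E]
    {R : E → ℝ} (hR : ContDiffAt ℝ 2 R 0) (ho : R =o[𝓝 0] fun x => ‖x‖ ^ 2) :
    fderiv ℝ R 0 = 0 ∧ HasFDerivAt (fderiv ℝ R) (0 : E →L[ℝ] E →L[ℝ] ℝ) 0 := by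
  have hR0 : R 0 = 0 := by
    have := (ho.def one_pos).self_of_nhds
    simpa using this
  have hsq : (fun x : E => ‖x‖ ^ 2) =o[𝓝 0] fun x => x := by
    have h₁ : (fun x : E => ‖x‖) =o[𝓝 0] fun _ => (1 : ℝ) := by
      rw [isLittleO_one_iff]; simpa using (continuous_norm (E := E)).tendsto 0
    have h₂ := (h₁.mul_isBigO (isBigO_refl (fun x : E => ‖x‖) (𝓝 0)))
    exact isLittleO_norm_right.1 (by simpa only [one_mul, ← sq] using h₂)
  have hD0 : fderiv ℝ R 0 = 0 := by
    have : HasFDerivAt R (0 : E →L[ℝ] ℝ) 0 := by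
      rw [hasFDerivAt_iff_isLittleO_nhds_zero]
      simpa [hR0] using ho.trans hsq
    exact this.fderiv
  refine ⟨hD0, ?_⟩
  have hsymm : ∀ x y, fderiv ℝ (fderiv ℝ R) 0 x y = fderiv ℝ (fderiv ℝ R) 0 y x := fun x y =>
    (hR.isSymmSndFDerivAt (by simp)).eq x y
  have hDd : HasFDerivAt (fderiv ℝ R) (fderiv ℝ (fderiv ℝ R) 0) 0 :=
    ((hR.fderiv_right (m := 1) (by norm_num)).differentiableAt (by norm_num)).hasFDerivAt
  set L := fderiv ℝ (fderiv ℝ R) 0 with hL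
  have hRd : ∀ᶠ x in 𝓝 (0 : E), DifferentiableAt ℝ R x := by
    filter_upwards [hR.eventually (by simp)] with x hx
    exact hx.differentiableAt (by norm_num)
  -- Mean value inequality on the ball of radius `‖x‖`, where the derivative `fderiv ℝ R y - L y` is
  -- at most `ε ‖x‖`; symmetry of `L` gives this form of the derivative.
  have hS : (fun x => R x - 1 / 2 * L x x) =o[𝓝 0] fun x => ‖x‖ ^ 2 := by
    rw [isLittleO_iff]
    intro ε hε
    have h₁ := hDd.isLittleO.def hε
    simp only [hD0, sub_zero] at h₁
    obtain ⟨δ, hδ, hb⟩ := Metric.eventually_nhds_iff.1 (h₁.and hRd)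
    filter_upwards [Metric.ball_mem_nhds (0 : E) hδ] with x hx
    have hd : ∀ y ∈ Metric.closedBall (0 : E) ‖x‖,
        HasFDerivWithinAt (fun x => R x - 1 / 2 * L x x) (fderiv ℝ R y - L y)
          (Metric.closedBall (0 : E) ‖x‖) y := by
      intro y hy
      have hy' : dist y 0 < δ := (Metric.mem_closedBall.1 hy).trans_lt (by simpa using hx)
      have h₂ : HasFDerivAt (fun x => L x x) (((L y).comp (ContinuousLinearMap.id ℝ E)) +
          L.flip y) y := L.hasFDerivAt.clm_apply (hasFDerivAt_id y)
      have h₃ := ((hb hy').2.hasFDerivAt.sub (h₂.const_mul (1 / 2))).hasFDerivWithinAt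
        (s := Metric.closedBall (0 : E) ‖x‖)
      refine h₃.congr_fderiv ?_
      ext w
      simp [hsymm w y]
      ring
    have hn : ∀ y ∈ Metric.closedBall (0 : E) ‖x‖, ‖fderiv ℝ R y - L y‖ ≤ ε * ‖x‖ := by
      intro y hy
      have hy₁ : ‖y‖ ≤ ‖x‖ := by simpa using hy
      have hy' : dist y 0 < δ := (Metric.mem_closedBall.1 hy).trans_lt (by simpa using hx)
      exact (hb hy').1.trans (by gcongr)
    have h₄ := Convex.norm_image_sub_le_of_norm_hasFDerivWithin_le hd hn
      (convex_closedBall 0 ‖x‖) (Metric.mem_closedBall_self (norm_nonneg x))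
      (show x ∈ Metric.closedBall (0 : E) ‖x‖ by simp)
    simpa [hR0, sq, mul_assoc] using h₄
  have hq : (fun x => L x x) =o[𝓝 0] fun x => ‖x‖ ^ 2 := by
    have := (ho.sub hS).const_mul_left 2
    refine this.congr_left fun x => ?_
    ring
  have hzero : ∀ y, L y y = 0 := by
    intro y
    have ht : Tendsto (fun t : ℝ => t • y) (𝓝[≠] 0) (𝓝 0) := by
      have : Tendsto (fun t : ℝ => t • y) (𝓝 0) (𝓝 ((0 : ℝ) • y)) :=
        (continuous_id.smul continuous_const).tendsto 0
      rw [zero_smul] at this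
      exact this.mono_left nhdsWithin_le_nhds
    by_contra hne
    obtain ⟨c, hc, hlt⟩ : ∃ c > 0, c * ‖y‖ ^ 2 < ‖L y y‖ := by
      refine ⟨‖L y y‖ / (2 * (‖y‖ ^ 2 + 1)), by positivity, ?_⟩
      have : 0 < ‖L y y‖ := norm_pos_iff.2 hne
      rw [div_mul_eq_mul_div, div_lt_iff₀ (by positivity)]
      nlinarith [sq_nonneg ‖y‖]
    obtain ⟨t, h₁, h₂⟩ := ((ht.eventually (hq.def hc)).and self_mem_nhdsWithin).exists
    have ht0 : 0 < |t| ^ 2 := by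
      have : 0 < |t| := abs_pos.2 h₂
      positivity
    simp only [map_smul, _root_.smul_apply, smul_eq_mul, norm_mul, norm_smul,
      Real.norm_eq_abs, mul_pow, norm_pow, abs_abs, abs_norm] at h₁
    rw [Real.norm_eq_abs] at hlt
    nlinarith
  have hL0 : L = 0 := by
    ext x y
    have h₁ := hzero (x + y)
    simp only [map_add, _root_.add_apply, hzero, hsymm y x] at h₁
    simp only [_root_.zero_apply]
    linarith
  rwa [hL0] at hDd

/-- `HasQuadraticPart` bounds only values of `E`; smoothness turns this into information on
derivatives, through the remainder `E - ½ xᵀVx`. -/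
theorem HasQuadraticPart.hasFDerivAt_gradient {n : ℕ} {E : EuclideanSpace ℝ (Fin n) → ℝ}
    {V : Matrix (Fin n) (Fin n) ℝ} (hE : ContDiffAt ℝ ∞ E 0) (hV : HasQuadraticPart E V) :
    ∇ E 0 = 0 ∧ HasFDerivAt (∇ E) (toEuclideanCLM (𝕜 := ℝ) V) 0 := by
  set T := toEuclideanCLM (𝕜 := ℝ) V with hT
  have hTsymm : ∀ x y, inner ℝ x (T y) = inner ℝ y (T x) := fun x y => by
    rw [hT, inner_toEuclideanCLM, inner_toEuclideanCLM, dotProduct_mulVec, ← mulVec_transpose,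
      hV.1.eq, dotProduct_comm]
  have ho : (fun x => E x - 1 / 2 * inner ℝ x (T x)) =o[𝓝 0] fun x => ‖x‖ ^ 2 := by
    simpa only [hT, inner_toEuclideanCLM] using hV.2
  have hq : ∀ x, HasFDerivAt (fun x => 1 / 2 * inner ℝ x (T x))
      (InnerProductSpace.toDual ℝ _ (T x)) x := by
    intro x
    have h := ((hasFDerivAt_id x).inner ℝ T.hasFDerivAt).const_mul (1 / 2)
    refine h.congr_fderiv ?_
    ext w
    simp [hTsymm x w, real_inner_comm]
    ring
  have hE2 : ContDiffAt ℝ 2 E 0 := contDiffAt_infty.1 hE 2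
  have hR : ContDiffAt ℝ 2 (fun x => E x - 1 / 2 * inner ℝ x (T x)) 0 :=
    hE2.sub (contDiffAt_const.mul (contDiffAt_id.inner ℝ T.contDiff.contDiffAt))
  obtain ⟨h₀, h₁⟩ := hasFDerivAt_fderiv_of_isLittleO_sq hR ho
  have hgrad : ∀ᶠ x in 𝓝 0, ∇ E x - T x = (InnerProductSpace.toDual ℝ _).symm
      (fderiv ℝ (fun x => E x - 1 / 2 * inner ℝ x (T x)) x) := by
    filter_upwards [hE2.eventually (by simp)] with x hx
    have h := ((hx.differentiableAt (by norm_num)).hasFDerivAt.sub (hq x)).fderiv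
    rw [show (fun x => E x - 1 / 2 * inner ℝ x (T x)) = E - fun x => 1 / 2 * inner ℝ x (T x)
      from rfl, h, map_sub, LinearIsometryEquiv.symm_apply_apply]
    rfl
  have hg0 : ∇ E 0 = 0 := by
    have := hgrad.self_of_nhds
    rwa [h₀, map_zero, map_zero, sub_zero] at this
  refine ⟨hg0, ?_⟩
  rw [hasFDerivAt_iff_isLittleO_nhds_zero] at h₁ ⊢
  simp only [zero_add, h₀, hg0, sub_zero, _root_.zero_apply] at h₁ ⊢
  refine (isLittleO_norm_left.1 ?_)
  refine (isLittleO_norm_left.2 h₁).congr' ?_ (Eventually.of_forall fun _ => rfl)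
  filter_upwards [hgrad] with x hx
  rw [hx, LinearIsometryEquiv.norm_map]

/-! ### First order behaviour of the system -/

theorem kronPow_succ_apply {n : ℕ} (x : Fin n → ℝ) (k : ℕ) (i : Fin (n ^ (k + 1))) :
    kronPow x (k + 1) i = kronPow x k (finProdFinEquiv.symm (Fin.cast (pow_succ n k) i)).1 *
      x (finProdFinEquiv.symm (Fin.cast (pow_succ n k) i)).2 := rfl

theorem kronPow_zero {n k : ℕ} (hk : k ≠ 0) : kronPow (0 : Fin n → ℝ) k = 0 := by
  obtain ⟨k, rfl⟩ := Nat.exists_eq_succ_of_ne_zero hk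
  funext i
  rw [kronPow_succ_apply]
  simp

theorem differentiable_kronPow {n : ℕ} (k : ℕ) :
    Differentiable ℝ fun x : Fin n → ℝ => kronPow x k := by
  induction k with
  | zero => exact differentiable_const _
  | succ k ih =>
    rw [differentiable_pi] at ih ⊢
    intro i
    simp only [kronPow_succ_apply]
    exact (ih _).mul (differentiable_apply _)

/-- Each entry is a product of two functions vanishing at `0`. -/
theorem hasFDerivAt_kronPow {n k : ℕ} (hk : 2 ≤ k) :
    HasFDerivAt (fun x : Fin n → ℝ => kronPow x k) (0 : (Fin n → ℝ) →L[ℝ] Fin (n ^ k) → ℝ) 0 := by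
  obtain ⟨k, rfl⟩ := Nat.exists_eq_add_of_le' hk
  rw [hasFDerivAt_pi']
  intro i
  simp only [kronPow_succ_apply _ (k + 1)]
  have h₁ := (differentiable_pi.1 (differentiable_kronPow (n := n) (k + 1))
    (finProdFinEquiv.symm (Fin.cast (pow_succ n (k + 1)) i)).1) 0
  have h₂ := hasFDerivAt_apply (𝕜 := ℝ) (finProdFinEquiv.symm (Fin.cast (pow_succ n (k + 1)) i)).2
    (0 : Fin n → ℝ)
  refine (h₁.hasFDerivAt.mul h₂).congr_fderiv ?_
  simp [kronPow_zero]

/-- A linear map plus terms of higher order in Kronecker powers. -/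
theorem hasFDerivAt_mulVec_add_sum_kronPow {n a ℓ : ℕ} (A : Matrix (Fin a) (Fin n) ℝ)
    (F : (p : ℕ) → Matrix (Fin a) (Fin (n ^ p)) ℝ) :
    HasFDerivAt (fun x : Fin n → ℝ => A *ᵥ x + ∑ p ∈ Icc 2 ℓ, F p *ᵥ kronPow x p)
      A.mulVecLin.toContinuousLinearMap 0 := by
  have h : HasFDerivAt (fun x : Fin n → ℝ => ∑ p ∈ Icc 2 ℓ, F p *ᵥ kronPow x p)
      (∑ p ∈ Icc 2 ℓ, (0 : (Fin n → ℝ) →L[ℝ] Fin a → ℝ)) 0 := by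
    refine HasFDerivAt.fun_sum fun p hp => ?_
    have h₁ := (F p).mulVecLin.toContinuousLinearMap.hasFDerivAt.comp (0 : Fin n → ℝ)
      (hasFDerivAt_kronPow (n := n) (mem_Icc.1 hp).1)
    rw [ContinuousLinearMap.comp_zero] at h₁
    exact h₁
  have := A.mulVecLin.toContinuousLinearMap.hasFDerivAt (x := (0 : Fin n → ℝ)) |>.add h
  rw [Finset.sum_const_zero, add_zero] at this
  exact this

namespace PolySystem

variable {n m r : ℕ} (S : PolySystem n m r)

theorem hasFDerivAt_f : HasFDerivAt S.f S.A.mulVecLin.toContinuousLinearMap 0 :=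
  hasFDerivAt_mulVec_add_sum_kronPow S.A S.F

theorem hasFDerivAt_h : HasFDerivAt S.h S.C.mulVecLin.toContinuousLinearMap 0 :=
  hasFDerivAt_mulVec_add_sum_kronPow S.C S.H

theorem f_zero : S.f 0 = 0 := by
  have : ∀ p ∈ Icc 2 S.ℓ, S.F p *ᵥ kronPow 0 p = 0 := fun p hp => by
    rw [kronPow_zero (by have := (mem_Icc.1 hp).1; omega), mulVec_zero]
  rw [f, mulVec_zero, Finset.sum_congr rfl this, Finset.sum_const_zero, add_zero]

theorem h_zero : S.h 0 = 0 := by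
  have : ∀ p ∈ Icc 2 S.ℓ, S.H p *ᵥ kronPow 0 p = 0 := fun p hp => by
    rw [kronPow_zero (by have := (mem_Icc.1 hp).1; omega), mulVec_zero]
  rw [h, mulVec_zero, Finset.sum_congr rfl this, Finset.sum_const_zero, add_zero]

theorem g_zero : S.g 0 = S.B := by
  refine (congrArg (· + S.B) (Finset.sum_eq_zero fun p hp => ?_)).trans (zero_add _)
  have h0 : kron (colMat (0 : Fin (n ^ p) → ℝ)) (1 : Matrix (Fin m) (Fin m) ℝ) = 0 := by
    ext i j
    simp only [kron, reindex_apply, submatrix_apply, kroneckerMap_apply, colMat, Pi.zero_apply,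
      zero_mul, Matrix.zero_apply]
  rw [kronPow_zero (by have := (mem_Icc.1 hp).1; omega), h0]
  exact congrArg (castMat rfl (one_mul m)) (Matrix.mul_zero (S.G p))

theorem continuous_g : Continuous S.g := by
  unfold g
  refine Continuous.add (continuous_finsetSum _ fun p _ => ?_) continuous_const
  refine Continuous.matrix_submatrix (Continuous.matrix_mul continuous_const ?_) _ _
  refine continuous_matrix fun i j => ?_
  simp only [kron, colMat, reindex_apply, submatrix_apply, kroneckerMap_apply]
  exact ((continuous_apply _).comp (differentiable_kronPow p).continuous).mul continuous_const

end PolySystem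

/-- As `p` vanishes at `0`, only the value `k 0` matters to first order. Continuity of `g gᵀ` is
thus enough, and the linearization sees it only as `B Bᵀ`. -/
theorem hasFDerivAt_mul_of_continuousAt {E : Type*} [NormedAddCommGroup E] [NormedSpace ℝ E]
    {k p : E → ℝ} {p' : E →L[ℝ] ℝ} (hk : ContinuousAt k 0) (hp : HasFDerivAt p p' 0)
    (hp0 : p 0 = 0) : HasFDerivAt (fun x => k x * p x) (k 0 • p') 0 := by
  rw [hasFDerivAt_iff_isLittleO_nhds_zero] at hp ⊢
  simp only [zero_add, hp0, sub_zero, mul_zero] at hp ⊢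
  have h₁ : (fun x => k x * (p x - p' x)) =o[𝓝 0] fun x => x := by
    exact isLittleO_norm_right.1 (by simpa using (hk.isBigO_one ℝ).mul_isLittleO hp.norm_right)
  have h₂ : (fun x => (k x - k 0) * p' x) =o[𝓝 0] fun x => x := by
    have h₃ : (fun x => k x - k 0) =o[𝓝 0] fun _ => (1 : ℝ) := by
      rw [isLittleO_one_iff]; simpa using hk.tendsto.sub_const (k 0)
    exact isLittleO_norm_right.1
      (by simpa using h₃.mul_isBigO (p'.isBigO_id (𝓝 0)).norm_right)
  refine (h₁.add h₂).congr_left fun x => ?_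
  simp only [_root_.smul_apply, smul_eq_mul]
  ring

theorem hasFDerivAt_mulVec_of_continuousAt {E : Type*} [NormedAddCommGroup E] [NormedSpace ℝ E]
    {a b : ℕ} {K : E → Matrix (Fin a) (Fin b) ℝ} {p : E → Fin b → ℝ} {p' : E →L[ℝ] Fin b → ℝ}
    (hK : ContinuousAt K 0) (hp : HasFDerivAt p p' 0) (hp0 : p 0 = 0) :
    HasFDerivAt (fun x => K x *ᵥ p x) ((K 0).mulVecLin.toContinuousLinearMap.comp p') 0 := by
  rw [hasFDerivAt_pi']
  intro i
  have h := HasFDerivAt.fun_sum (u := Finset.univ) (x := (0 : E)) fun j _ =>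
    hasFDerivAt_mul_of_continuousAt (k := fun x => K x i j) (p := fun x => p x j)
      (((continuous_apply_apply i j).continuousAt).comp hK) (hasFDerivAt_pi'.1 hp j)
      (congrFun hp0 j)
  refine h.congr_fderiv ?_
  ext w
  simp [mulVec, dotProduct]

theorem tendsto_inv_smul_of_hasFDerivAt {E F : Type*} [NormedAddCommGroup E] [NormedSpace ℝ E]
    [NormedAddCommGroup F] [NormedSpace ℝ F] {p : E → F} {p' : E →L[ℝ] F}
    (hp : HasFDerivAt p p' 0) (hp0 : p 0 = 0) (y : E) :
    Tendsto (fun t : ℝ => t⁻¹ • p (t • y)) (𝓝[≠] 0) (𝓝 (p' y)) := by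
  have := hasDerivAt_iff_tendsto_slope_zero.1 (hp.hasLineDerivAt y)
  simpa [hp0] using this

/-! ### Riccati equations and linearized vector fields from the energy functions -/

section Linearization

variable {n m r : ℕ} (S : PolySystem n m r) {E : EuclideanSpace ℝ (Fin n) → ℝ}
  {V : Matrix (Fin n) (Fin n) ℝ}

theorem hasFDerivAt_ofLp_gradient (hE : ContDiffAt ℝ ∞ E 0) (hV : HasQuadraticPart E V) :
    HasFDerivAt (fun x => (∇ E x).ofLp)
      ((PiLp.continuousLinearEquiv 2 ℝ fun _ : Fin n => ℝ).toContinuousLinearMap.comp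
        (toEuclideanCLM (𝕜 := ℝ) V)) 0 :=
  (PiLp.continuousLinearEquiv 2 ℝ fun _ : Fin n => ℝ).toContinuousLinearMap.hasFDerivAt.comp 0
    (hV.hasFDerivAt_gradient hE).2

theorem hasFDerivAt_comp_ofLp {a : ℕ} {φ : (Fin n → ℝ) → Fin a → ℝ}
    {φ' : (Fin n → ℝ) →L[ℝ] Fin a → ℝ} (h : HasFDerivAt φ φ' 0) :
    HasFDerivAt (fun x : EuclideanSpace ℝ (Fin n) => φ x.ofLp)
      (φ'.comp (PiLp.continuousLinearEquiv 2 ℝ fun _ : Fin n => ℝ).toContinuousLinearMap) 0 :=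
  HasFDerivAt.comp (0 : EuclideanSpace ℝ (Fin n)) h
    (PiLp.continuousLinearEquiv 2 ℝ fun _ : Fin n => ℝ).toContinuousLinearMap.hasFDerivAt

theorem continuous_g_mul_transpose :
    Continuous fun x : EuclideanSpace ℝ (Fin n) => S.g x.ofLp * (S.g x.ofLp)ᵀ := by
  have : Continuous fun x : EuclideanSpace ℝ (Fin n) => S.g x.ofLp :=
    S.continuous_g.comp (PiLp.continuous_ofLp 2 _)
  exact this.matrix_mul this.matrix_transpose

/-- The quadratic part of a Hamilton-Jacobi-Bellman equation is a Riccati equation. -/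
theorem riccati_of_hjb (hE : ContDiffAt ℝ ∞ E 0) (hV : HasQuadraticPart E V) {α β : ℝ}
    (hjb : ∀ᶠ x in 𝓝 (0 : EuclideanSpace ℝ (Fin n)), (∇ E x).ofLp ⬝ᵥ S.f x.ofLp
      + α * ((∇ E x).ofLp ⬝ᵥ ((S.g x.ofLp * (S.g x.ofLp)ᵀ) *ᵥ (∇ E x).ofLp))
      + β * (S.h x.ofLp ⬝ᵥ S.h x.ofLp) = 0) (y : Fin n → ℝ) :
    (V *ᵥ y) ⬝ᵥ (S.A *ᵥ y) + α * ((S.Bᵀ *ᵥ (V *ᵥ y)) ⬝ᵥ (S.Bᵀ *ᵥ (V *ᵥ y))) +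
      β * ((S.C *ᵥ y) ⬝ᵥ (S.C *ᵥ y)) = 0 := by
  set e : EuclideanSpace ℝ (Fin n) := WithLp.toLp 2 y with he
  -- The gradient, `f` and `h` all vanish at `0`, so the HJB equation at `t • e`, divided by `t²`,
  -- has a limit given by their linear parts.
  have hp := tendsto_inv_smul_of_hasFDerivAt (hasFDerivAt_ofLp_gradient hE hV)
    (by rw [(hV.hasFDerivAt_gradient hE).1]; rfl) e
  have hf := tendsto_inv_smul_of_hasFDerivAt (hasFDerivAt_comp_ofLp S.hasFDerivAt_f) S.f_zero e
  have hh := tendsto_inv_smul_of_hasFDerivAt (hasFDerivAt_comp_ofLp S.hasFDerivAt_h) S.h_zero e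
  have ht : Tendsto (fun t : ℝ => t • e) (𝓝[≠] 0) (𝓝 0) := by
    have : Tendsto (fun t : ℝ => t • e) (𝓝 0) (𝓝 ((0 : ℝ) • e)) :=
      (continuous_id.smul continuous_const).tendsto 0
    rw [zero_smul] at this
    exact this.mono_left nhdsWithin_le_nhds
  have hg := ((continuous_g_mul_transpose S).tendsto 0).comp ht
  have hdot : ∀ {a : ℕ} {u w : ℝ → Fin a → ℝ} {u₀ w₀ : Fin a → ℝ},
      Tendsto u (𝓝[≠] 0) (𝓝 u₀) → Tendsto w (𝓝[≠] 0) (𝓝 w₀) →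
        Tendsto (fun t => u t ⬝ᵥ w t) (𝓝[≠] 0) (𝓝 (u₀ ⬝ᵥ w₀)) := fun hu hw =>
    ((continuous_fst.dotProduct continuous_snd).tendsto _).comp (hu.prodMk_nhds hw)
  have hgp := (((continuous_fst.matrix_mulVec continuous_snd).tendsto _).comp (hg.prodMk_nhds hp))
  have hlim := ((hdot hp hf).add ((hdot hp hgp).const_mul α)).add ((hdot hh hh).const_mul β)
  have := tendsto_nhds_unique (hlim.congr' (f₂ := fun _ => (0 : ℝ)) ?_) tendsto_const_nhds
  · have hB : (V *ᵥ y) ⬝ᵥ ((S.B * S.Bᵀ) *ᵥ (V *ᵥ y)) =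
        (S.Bᵀ *ᵥ (V *ᵥ y)) ⬝ᵥ (S.Bᵀ *ᵥ (V *ᵥ y)) := by
      rw [← mulVec_mulVec, dotProduct_mulVec, ← mulVec_transpose]
    rw [← hB, ← S.g_zero]
    exact this
  · filter_upwards [ht.eventually hjb] with t h
    simp only [Function.comp_apply, mulVec_smul, dotProduct_smul, smul_dotProduct, smul_eq_mul]
    linear_combination t⁻¹ * t⁻¹ * h

/-- The pair `(σ, τ)` is `(-1, -1)` for the past energy and `(1, -η)` for the future energy. -/
theorem hasFDerivAt_vectorField (hE : ContDiffAt ℝ ∞ E 0) (hV : HasQuadraticPart E V) (σ τ : ℝ) :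
    HasFDerivAt (fun x : EuclideanSpace ℝ (Fin n) => WithLp.toLp 2
      (σ • S.f x.ofLp + τ • ((S.g x.ofLp * (S.g x.ofLp)ᵀ) *ᵥ (∇ E x).ofLp)))
      (toEuclideanCLM (𝕜 := ℝ) (σ • S.A + τ • (S.B * S.Bᵀ * V))) 0 := by
  have h₁ := (hasFDerivAt_comp_ofLp S.hasFDerivAt_f).const_smul σ
  have h₂ := (hasFDerivAt_mulVec_of_continuousAt (continuous_g_mul_transpose S).continuousAt
    (hasFDerivAt_ofLp_gradient hE hV)
    (by rw [(hV.hasFDerivAt_gradient hE).1]; rfl)).const_smul τ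
  have h₃ := (PiLp.continuousLinearEquiv 2 ℝ fun _ : Fin n =>
    ℝ).symm.toContinuousLinearMap.hasFDerivAt.comp (0 : EuclideanSpace ℝ (Fin n)) (h₁.add h₂)
  refine h₃.congr_fderiv ?_
  ext w i
  change σ * (S.A *ᵥ w.ofLp) i + τ * ((S.g 0 * (S.g 0)ᵀ) *ᵥ (V *ᵥ w.ofLp)) i =
    ((σ • S.A + τ • (S.B * S.Bᵀ * V)) *ᵥ w.ofLp) i
  rw [S.g_zero, add_mulVec, smul_mulVec, smul_mulVec, mulVec_mulVec]
  rfl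

theorem AsymptoticallyStable.re_spectrum_le_of_energy (hE : ContDiffAt ℝ ∞ E 0)
    (hV : HasQuadraticPart E V) {σ τ : ℝ}
    (h : AsymptoticallyStable fun x : EuclideanSpace ℝ (Fin n) => WithLp.toLp 2
      (σ • S.f x.ofLp + τ • ((S.g x.ofLp * (S.g x.ofLp)ᵀ) *ᵥ (∇ E x).ofLp))) :
    ∀ μ ∈ spectrum ℂ ((σ • S.A + τ • (S.B * S.Bᵀ * V)).map (fun a : ℝ => (a : ℂ))), μ.re ≤ 0 := by
  refine h.re_spectrum_le (hasFDerivAt_vectorField S hE hV σ τ) ?_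
  simp [S.f_zero, (hV.hasFDerivAt_gradient hE).1]

end Linearization

end NLBalancing

/-! ### Unique solvability of both systems -/

theorem theorem3 {n m r : ℕ} (S : PolySystem n m r) (γ₀ γ η : ℝ)
    (hγ₀ : IsGLB (admissibleLevels S.A S.B S.C) γ₀) (hγ : γ₀ < γ) (hη : η = 1 - γ ^ (-2 : ℤ)) :
    (∀ (E : EuclideanSpace ℝ (Fin n) → ℝ) (V₂ : Matrix (Fin n) (Fin n) ℝ)
        (v : (i : ℕ) → Fin (n ^ i) → ℝ),
        IsPastEnergy S η E → HasQuadraticPart E V₂ →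
        v 2 = castVec (pow_two n).symm (vecMat V₂) →
        ∀ (k : ℕ) (hk : 3 ≤ k), ∃! t : Fin (n ^ k) → ℝ, SolvesPastSystem S η V₂ v hk t) ∧
      ∀ (E : EuclideanSpace ℝ (Fin n) → ℝ) (W₂ : Matrix (Fin n) (Fin n) ℝ)
        (w : (i : ℕ) → Fin (n ^ i) → ℝ),
        IsFutureEnergy S η E → HasQuadraticPart E W₂ →
        w 2 = castVec (pow_two n).symm (vecMat W₂) →
        ∀ (k : ℕ) (hk : 3 ≤ k), ∃! t : Fin (n ^ k) → ℝ, SolvesFutureSystem S η W₂ w hk t := by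
  obtain ⟨c, hc, -, hcγ⟩ := hγ₀.exists_between hγ
  constructor
  · intro E V v hE hV _ k hk
    refine existsUnique_lyap ?_ _ _
    have hric := re_spectrum_ne_zero_of_riccati hc hcγ hV.1 fun x => by
      have := riccati_of_hjb S hE.smooth hV (α := 1 / 2) (β := -(η / 2))
        (by simpa only [neg_mul, ← sub_eq_add_neg] using hE.hjb) x
      rw [← hη]
      linear_combination 2 * this
    have hst := AsymptoticallyStable.re_spectrum_le_of_energy S hE.smooth hV (σ := -1) (τ := -1)
      (by simpa only [neg_smul, one_smul, ← sub_eq_add_neg] using hE.stable)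
    -- The past field runs backwards, so it is the negative of the matrix in the system that is
    -- Hurwitz; the sign does not affect invertibility of `lyapSq`.
    have hM : IsHurwitz (-(S.A + S.B * S.Bᵀ * V)) := by
      intro μ hμ
      refine lt_of_le_of_ne (hst μ ?_) fun h0 => ?_
      · rwa [neg_smul, neg_smul, one_smul, one_smul, ← neg_add]
      · refine hric (-μ) ?_ (by rw [Complex.neg_re, h0, neg_zero])
        rw [← neg_neg (S.A + S.B * S.Bᵀ * V), Matrix.map_neg _ Complex.ofReal_neg,
          ← spectrum.neg_eq]
        simpa using hμ
    have := hM.isUnit_lyapSq (k := k) (by omega)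
    rwa [lyapSq_neg, IsUnit.neg_iff] at this
  · intro E W w hE hW _ k hk
    refine existsUnique_lyap ?_ _ _
    -- Multiplying the future Riccati equation by `-η` gives the past one for `-η W`, for every sign
    -- of `η`, so the same exclusion of imaginary eigenvalues applies.
    have hQ : (-η • W).IsSymm := hW.1.smul _
    have hric := re_spectrum_ne_zero_of_riccati hc hcγ hQ fun x => by
      have := riccati_of_hjb S hE.smooth hW (α := -(η / 2)) (β := 1 / 2)
        (by simpa only [neg_mul, ← sub_eq_add_neg] using hE.hjb) x
      rw [← hη]
      simp only [smul_mulVec, mulVec_smul, smul_dotProduct, dotProduct_smul, smul_eq_mul]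
      linear_combination -2 * η * this
    have hst := AsymptoticallyStable.re_spectrum_le_of_energy S hE.smooth hW (σ := 1) (τ := -η)
      (by simpa only [neg_smul, one_smul, ← sub_eq_add_neg] using hE.stable)
    have hM : IsHurwitz (S.A - η • (S.B * S.Bᵀ * W)) := by
      intro μ hμ
      refine lt_of_le_of_ne (hst μ ?_) (hric μ ?_)
      · rwa [one_smul, neg_smul, ← sub_eq_add_neg]
      · rwa [Matrix.mul_smul, neg_smul, ← sub_eq_add_neg]
    exact hM.isUnit_lyapSq (by omega)
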